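/- **Setting.** Let $0<\mu<L$, $\rho\in(0,1)$, $\ell\in\mathbb N$ and $d\ge 1$. Let $S\in\mathbb R^{p\times p}$ be an exosystem model: all its eigenvalues $e_1,\dots,e_p$ (with multiplicity) have unit modulus and all trajectories of $\theta_{k+1}=S\theta_k$ are bounded. Assume that the set of harmonics $\Omega=\{e_1^{\alpha_1}\cdots e_p^{\alpha_p}\mid\alpha\in\mathbb N^p\}$ is finite, put $n_p=|\Omega|$ and $H(z)=z^{n_p-1}/\prod_{\omega\in\Omega}(z-\omega)$, and let $(A_p,B_p,C_p,0)$ be any real state-space realization of $H$ with state dimension $n_p$. Write $M_\perp$ for a matrix whose columns are a basis of the kernel of $M$. *Algorithms.* An algorithm is $x_{k+1}=(A\otimes I_d)x_k+(B\otimes I_d)w_k$, $z_k=(C\otimes I_d)x_k$ with $A\in\mathbb R^{n\times n}$, $B\in\mathbb R^{n\times1}$, $C\in\mathbb R^{1\times n}$, $(A,C)$ detectable, and such that some $x_*$ satisfies $(A\otimes I_d)x_*=x_*$ and $(C\otimes I_d)x_*\ne0$. It has internal-model form with controller $K=(A_c,B_c,C_c,D_c)$ of dimension $n_c$ (a real realization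 of a proper transfer function) if $C(zI-A)^{-1}B=K(z)H(z)$. *Filter.* For $\lambda=(\lambda_0,\dots,\lambda_\ell)\in\mathbb R^{\ell+1}$ let $A_f\in\mathbb R^{\ell\times\ell}$ have ones on the first superdiagonal and zeros elsewhere, $B_f=(0,\dots,0,1)^{\mathsf T}\in\mathbb R^\ell$, $C_f=(\lambda_\ell,\dots,\lambda_1)$, $D_f=\lambda_0$, and let $$\Lambda_\ell^\rho=\Bigl\{\lambda\;\Big|\;\lambda_1,\dots,\lambda_\ell\le0,\ \sum_{j=0}^\ell\rho^{-j}\lambda_j\ge0\Bigr\}.$$ *Generalized plant.* Let $$\hat A=\begin{pmatrix}A_f&0\\0&\rho^{-1}A_p\end{pmatrix},\quad \hat B_w=\begin{pmatrix}-B_f\\\rho^{-1}B_p\end{pmatrix},\quad \hat B=\begin{pmatrix}(L-\mu)B_f\\\rho^{-1}\mu B_p\end{pmatrix},$$ $$\hat C_z=(C_f\ \ 0),\quad \hat D_{zw}=-D_f,\quad \hat D_z=(L-\mu)D_f,\quad \hat C=(0\ \ C_p).$$ Closing the loop with the weighted controller $(\rho^{-1}A_c,\rho^{-1}B_c,C_c,D_c)$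 gives $$\mathcal A=\begin{pmatrix}\hat A+\hat BD_c\hat C&\hat BC_c\\\rho^{-1}B_c\hat C&\rho^{-1}A_c\end{pmatrix},\quad \mathcal B=\begin{pmatrix}\hat B_w\\0\end{pmatrix},\quad \mathcal C=(\hat C_z+\hat D_zD_c\hat C\ \ \ \hat D_zC_c),\quad \mathcal D=\hat D_{zw}.$$ *Analysis LMI*, for symmetric $\mathcal X$ of size $n_p+\ell+n_c$: $$\mathcal X\succ0,\qquad \begin{pmatrix}\mathcal A&\mathcal B\\I&0\\\mathcal C&\mathcal D\\0&1\end{pmatrix}^{\mathsf T}\begin{pmatrix}\mathcal X&0&0&0\\0&-\mathcal X&0&0\\0&0&0&1\\0&0&1&0\end{pmatrix}\begin{pmatrix}\mathcal A&\mathcal B\\I&0\\\mathcal C&\mathcal D\\0&1\end{pmatrix}\prec0.$$ *Synthesis conditions*, for $N\in\mathbb R^{n_p\times\ell}$ and symmetric $\hat X$, $\tilde Y$ of sizes $n_p+\ell$ and $n_p$: with $\hat U=\operatorname{diag}(I_\ell,{C_p}_\perp,1)$, $V^{\mathsf T}=(\rho^{-1}\mu B_p^{\mathsf T}\ \ L-\mu)_\perp$,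 $\tilde T=\bigl((L-\mu)^{-1}N\ \ \sum_{j=0}^\ell\lambda_j\rho^jA_p^{-j}\bigr)$, $$F=\begin{pmatrix}\hat A&\hat B_w\\I&0\\\hat C_z&\hat D_{zw}\\0&1\end{pmatrix}\hat U,\qquad E=V\begin{pmatrix}-I&A_p&0&\tilde T\hat B_w\\0&0&-1&\hat D_{zw}\end{pmatrix},$$ the Sylvester equation (N) is $A_pN-\rho NA_f+\mu B_pC_f=0$, and the LMIs (synthesis) are $$F^{\mathsf T}\begin{pmatrix}\hat X&0&0&0\\0&-\hat X&0&0\\0&0&0&1\\0&0&1&0\end{pmatrix}F\prec0,\qquad E\begin{pmatrix}\tilde Y&0&0&0\\0&-\rho^{-2}\tilde Y&0&0\\0&0&0&1\\0&0&1&0\end{pmatrix}E^{\mathsf T}\succ0,\qquad\begin{pmatrix}\tilde Y&\tilde T\\\tilde T^{\mathsf T}&\hat X\end{pmatrix}\succ0.$$ **Theorem.** The following are equivalent. 1. There exist an algorithm $(A,B,C)$ of internal-model form with some controller $K$ of some dimension $n_c$, a symmetric $\mathcal X$ and $\lambda\in\Lambda_\ell^\rho$ such that the analysis LMI holds. 2.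 There exist $N\in\mathbb R^{n_p\times\ell}$, symmetric matrices $\hat X\in\mathbb R^{(n_p+\ell)\times(n_p+\ell)}$ and $\tilde Y\in\mathbb R^{n_p\times n_p}$, and $\lambda\in\Lambda_\ell^\rho$ that satisfy the Sylvester equation (N) and the LMIs (synthesis). Moreover, the constraints in 2 are convex: the set of all $(N,\hat X,\tilde Y,\lambda)$ satisfying them is convex. -/

import Mathlib

open Matrix
open scoped Kronecker

noncomputable section

namespace TVOpt

/-! ### Linear time-invariant systems -/

/-- A single-input single-output discrete-time LTI system in state-space form,
`x⁺ = A x + B u`, `y = C x + D u`. -/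
structure LTI (n : Type) where
  A : Matrix n n ℝ
  B : Matrix n (Fin 1) ℝ
  C : Matrix (Fin 1) n ℝ
  D : Matrix (Fin 1) (Fin 1) ℝ

/-- The embedding of the real numbers into the field of complex rational functions. -/
def toRatFunc : ℝ →+* RatFunc ℂ := (RatFunc.C : ℂ →+* RatFunc ℂ).comp Complex.ofRealHom

/-- The transfer function `C (z I - A)⁻¹ B + D`, as a rational function of `z`. -/
def LTI.transferFunction {n : Type} [Fintype n] [DecidableEq n] (G : LTI n) : RatFunc ℂ :=
  (G.C.map toRatFunc * ((RatFunc.X : RatFunc ℂ) • (1 : Matrix n n (RatFunc ℂ))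
      - G.A.map toRatFunc)⁻¹ * G.B.map toRatFunc + G.D.map toRatFunc) 0 0

/-- Detectability of `(A, C)` in discrete time: every trajectory of `x⁺ = A x` that produces
zero output `C x` converges to zero. -/
def Detectable {n : Type} [Fintype n] [DecidableEq n]
    (A : Matrix n n ℝ) (C : Matrix (Fin 1) n ℝ) : Prop :=
  ∀ x : n → ℝ, (∀ k : ℕ, C *ᵥ (A ^ k *ᵥ x) = 0) →
    Filter.Tendsto (fun k : ℕ => A ^ k *ᵥ x) Filter.atTop (nhds 0)

/-- `G` is an admissible first-order algorithm
`x⁺ = (A ⊗ I_d) x + (B ⊗ I_d) w`, `z = (C ⊗ I_d) x` in `ℝ^d`: it is strictly proper, `(A, C)` is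
detectable, and there is a fixed point with nonzero output. -/
structure IsAlgorithm (d : ℕ) {n : Type} [Fintype n] [DecidableEq n] (G : LTI n) : Prop where
  strictlyProper : G.D = 0
  detectable : Detectable G.A G.C
  fixedPoint : ∃ x : n × Fin d → ℝ,
    (G.A ⊗ₖ (1 : Matrix (Fin d) (Fin d) ℝ)) *ᵥ x = x ∧
    (G.C ⊗ₖ (1 : Matrix (Fin d) (Fin d) ℝ)) *ᵥ x ≠ 0

/-! ### Exosystem and internal model -/

/-- `S` is an admissible exosystem model, with eigenvalues `ev` (listed with multiplicity):
all eigenvalues have unit modulus and all trajectories of `θ⁺ = S θ` are bounded. -/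
structure IsExosystem {p : ℕ} (S : Matrix (Fin p) (Fin p) ℝ) (ev : Fin p → ℂ) : Prop where
  eigenvalues : (S.map Complex.ofReal).charpoly = ∏ i, (Polynomial.X - Polynomial.C (ev i))
  unitModulus : ∀ i, ‖ev i‖ = 1
  bounded : ∀ θ : ℕ → Fin p → ℝ, (∀ k, θ (k + 1) = S *ᵥ θ k) →
    Bornology.IsBounded (Set.range θ)

/-- The set of harmonics `ev^α = ∏ i, (ev i)^(α i)` over all multi-indices `α`. -/
def harmonics {p : ℕ} (ev : Fin p → ℂ) : Set ℂ :=
  Set.range fun α : Fin p → ℕ => ∏ i, ev i ^ α i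

/-- The internal model `H(z) = z^(|Ω| - 1) / ∏_{ω ∈ Ω} (z - ω)`. -/
def internalModel (Ω : Finset ℂ) : RatFunc ℂ :=
  RatFunc.X ^ (Ω.card - 1) / ∏ ω ∈ Ω, (RatFunc.X - RatFunc.C ω)

/-! ### Zames--Falb filter -/

/-- The set `Λ_ℓ^ρ` of Zames--Falb parameters. -/
def zfParams (ρ : ℝ) (ℓ : ℕ) : Set (Fin (ℓ + 1) → ℝ) :=
  {lam | (∀ j : Fin ℓ, lam j.succ ≤ 0) ∧ 0 ≤ ∑ j : Fin (ℓ + 1), (ρ ^ (j : ℕ))⁻¹ * lam j}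

/-- `A_f`: ones on the first superdiagonal. -/
def filterA (ℓ : ℕ) : Matrix (Fin ℓ) (Fin ℓ) ℝ :=
  Matrix.of fun i j => if (j : ℕ) = i + 1 then 1 else 0

/-- `B_f`: the last unit vector. -/
def filterB (ℓ : ℕ) : Matrix (Fin ℓ) (Fin 1) ℝ :=
  Matrix.of fun i _ => if (i : ℕ) + 1 = ℓ then 1 else 0

/-- `C_f = (λ_ℓ, λ_{ℓ-1}, …, λ_1)`. -/
def filterC {ℓ : ℕ} (lam : Fin (ℓ + 1) → ℝ) : Matrix (Fin 1) (Fin ℓ) ℝ :=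
  Matrix.of fun _ j => lam ⟨ℓ - j, by omega⟩

/-- `D_f = λ_0`. -/
def filterD {ℓ : ℕ} (lam : Fin (ℓ + 1) → ℝ) : Matrix (Fin 1) (Fin 1) ℝ :=
  Matrix.of fun _ _ => lam 0

/-! ### The transformed, filtered generalized plant

It is built from a realization `H` of the internal model. The state is `(x_f, x_p)`, the inputs
are `(q, u)` and the outputs are `(r, y)`. -/

section plant

variable {n : Type} [Fintype n] [DecidableEq n] {ℓ : ℕ}

/-- `Â` -/
def plantA (ρ : ℝ) (ℓ : ℕ) (H : LTI n) : Matrix (Fin ℓ ⊕ n) (Fin ℓ ⊕ n) ℝ :=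
  fromBlocks (filterA ℓ) 0 0 (ρ⁻¹ • H.A)

/-- `B̂_w` -/
def plantBw (ρ : ℝ) (ℓ : ℕ) (H : LTI n) : Matrix (Fin ℓ ⊕ n) (Fin 1) ℝ :=
  fromRows (-filterB ℓ) (ρ⁻¹ • H.B)

/-- `B̂` -/
def plantB (ρ μ L : ℝ) (ℓ : ℕ) (H : LTI n) : Matrix (Fin ℓ ⊕ n) (Fin 1) ℝ :=
  fromRows ((L - μ) • filterB ℓ) ((ρ⁻¹ * μ) • H.B)

/-- `Ĉ_z` -/
def plantCz (n : Type) (lam : Fin (ℓ + 1) → ℝ) : Matrix (Fin 1) (Fin ℓ ⊕ n) ℝ :=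
  fromCols (filterC lam) 0

/-- `D̂_zw` -/
def plantDzw (lam : Fin (ℓ + 1) → ℝ) : Matrix (Fin 1) (Fin 1) ℝ := -filterD lam

/-- `D̂_z` -/
def plantDz (μ L : ℝ) (lam : Fin (ℓ + 1) → ℝ) : Matrix (Fin 1) (Fin 1) ℝ :=
  (L - μ) • filterD lam

/-- `Ĉ` -/
def plantC (ℓ : ℕ) (H : LTI n) : Matrix (Fin 1) (Fin ℓ ⊕ n) ℝ :=
  fromCols 0 H.C

end plant

/-- The exponentially weighted system `T_{ρ⁻¹} ∘ G ∘ T_ρ`. -/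
def LTI.weighted {m : Type} (ρ : ℝ) (G : LTI m) : LTI m where
  A := ρ⁻¹ • G.A
  B := ρ⁻¹ • G.B
  C := G.C
  D := G.D

/-- The realization `(𝒜, ℬ, 𝒞, 𝒟)` of the system from `q` to `r` that results from closing the
loop `u = K̄ y` around the generalized plant, where `K̄` is the weighted controller. The state is
`((x_f, x_p), x_c)`. -/
def closedLoop {n m : Type} [Fintype n] [DecidableEq n]
    (ρ μ L : ℝ) {ℓ : ℕ} (H : LTI n) (lam : Fin (ℓ + 1) → ℝ) (K : LTI m) :
    LTI ((Fin ℓ ⊕ n) ⊕ m) where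
  A := fromBlocks
    (plantA ρ ℓ H + plantB ρ μ L ℓ H * (K.weighted ρ).D * plantC ℓ H)
    (plantB ρ μ L ℓ H * (K.weighted ρ).C)
    ((K.weighted ρ).B * plantC ℓ H)
    (K.weighted ρ).A
  B := fromRows (plantBw ρ ℓ H) 0
  C := fromCols
    (plantCz n lam + plantDz μ L lam * (K.weighted ρ).D * plantC ℓ H)
    (plantDz μ L lam * (K.weighted ρ).C)
  D := plantDzw lam

/-! ### Linear matrix inequalities -/

/-- `M ≺ 0` -/
def NegDef {n : Type} (M : Matrix n n ℝ) : Prop := (-M).PosDef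

/-- The middle matrix `diag (X, Y, [0 1; 1 0])`. -/
def middle {n : Type} (X Y : Matrix n n ℝ) :
    Matrix ((n ⊕ n) ⊕ (Fin 1 ⊕ Fin 1)) ((n ⊕ n) ⊕ (Fin 1 ⊕ Fin 1)) ℝ :=
  fromBlocks (fromBlocks X 0 0 Y) 0 0 (fromBlocks 0 1 1 0)

/-- The outer factor with block rows `(A B)`, `(I 0)`, `(C D)`, `(0 1)`. -/
def outer {n : Type} [DecidableEq n] (A : Matrix n n ℝ) (B : Matrix n (Fin 1) ℝ)
    (C : Matrix (Fin 1) n ℝ) (D : Matrix (Fin 1) (Fin 1) ℝ) :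
    Matrix ((n ⊕ n) ⊕ (Fin 1 ⊕ Fin 1)) (n ⊕ Fin 1) ℝ :=
  fromRows (fromBlocks A B 1 0) (fromBlocks C D 0 1)

/-- The analysis LMI for a closed-loop realization `G` and certificate `X`. -/
def AnalysisLMI {n : Type} [Fintype n] [DecidableEq n] (G : LTI n) (X : Matrix n n ℝ) : Prop :=
  X.PosDef ∧
    NegDef ((outer G.A G.B G.C G.D)ᵀ * middle X (-X) * outer G.A G.B G.C G.D)

/-- The columns of `W` are a basis of the kernel of `M` (that is, `W = M_⊥`). -/
def IsKernelBasis {m n k : Type} [Fintype n] (M : Matrix m n ℝ) (W : Matrix n k ℝ) : Prop :=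
  LinearIndependent ℝ W.col ∧ Submodule.span ℝ (Set.range W.col) = LinearMap.ker M.mulVecLin

section synthesis

variable {n : Type} [Fintype n] [DecidableEq n] {ℓ : ℕ}

/-- The row `(ρ⁻¹ μ B_pᵀ, L - μ)`, whose annihilator is `Vᵀ`. -/
def dualRow (ρ μ L : ℝ) (H : LTI n) : Matrix (Fin 1) (n ⊕ Fin 1) ℝ :=
  fromCols ((ρ⁻¹ * μ) • H.Bᵀ) ((L - μ) • (1 : Matrix (Fin 1) (Fin 1) ℝ))

/-- The Sylvester equation `A_p N - ρ N A_f + μ B_p C_f = 0`. -/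
def Sylvester (ρ μ : ℝ) (H : LTI n) (lam : Fin (ℓ + 1) → ℝ) (N : Matrix n (Fin ℓ) ℝ) : Prop :=
  H.A * N - ρ • (N * filterA ℓ) + μ • (H.B * filterC lam) = 0

/-- `T̃ = ((L - μ)⁻¹ N, ∑_j λ_j ρ^j A_p^{-j})`. -/
def tildeT (ρ μ L : ℝ) (H : LTI n) (lam : Fin (ℓ + 1) → ℝ) (N : Matrix n (Fin ℓ) ℝ) :
    Matrix n (Fin ℓ ⊕ n) ℝ :=
  fromCols ((L - μ)⁻¹ • N) (∑ j : Fin (ℓ + 1), (lam j * ρ ^ (j : ℕ)) • (H.A⁻¹) ^ (j : ℕ))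

/-- `Û = diag (I_ℓ, C_{p⊥}, 1)`. -/
def hatU {k : Type} (ℓ : ℕ) (Cperp : Matrix n k ℝ) :
    Matrix ((Fin ℓ ⊕ n) ⊕ Fin 1) ((Fin ℓ ⊕ k) ⊕ Fin 1) ℝ :=
  fromBlocks (fromBlocks 1 0 0 Cperp) 0 0 1

/-- The factor multiplying `middle X̂ (-X̂)` from the right in the primal LMI. -/
def primalFactor {k : Type} (ρ : ℝ) (H : LTI n) (Cperp : Matrix n k ℝ)
    (lam : Fin (ℓ + 1) → ℝ) :
    Matrix (((Fin ℓ ⊕ n) ⊕ (Fin ℓ ⊕ n)) ⊕ (Fin 1 ⊕ Fin 1)) ((Fin ℓ ⊕ k) ⊕ Fin 1) ℝ :=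
  outer (plantA ρ ℓ H) (plantBw ρ ℓ H) (plantCz n lam) (plantDzw lam) * hatU ℓ Cperp

/-- The factor multiplying `middle Ỹ (-ρ⁻² Ỹ)` from the left in the dual LMI; here `Vt = Vᵀ`. -/
def dualFactor {k : Type} (ρ μ L : ℝ) (H : LTI n) (Vt : Matrix (n ⊕ Fin 1) k ℝ)
    (lam : Fin (ℓ + 1) → ℝ) (N : Matrix n (Fin ℓ) ℝ) :
    Matrix k ((n ⊕ n) ⊕ (Fin 1 ⊕ Fin 1)) ℝ :=
  Vtᵀ * fromBlocks
    (fromCols (-1) H.A) (fromCols 0 (tildeT ρ μ L H lam N * plantBw ρ ℓ H))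
    (fromCols 0 0) (fromCols (-1) (plantDzw lam))

/-- The synthesis LMIs: primal, dual and coupling inequality. -/
structure SynthesisLMI {k₁ k₂ : Type} (ρ μ L : ℝ) (H : LTI n)
    (Cperp : Matrix n k₁ ℝ) (Vt : Matrix (n ⊕ Fin 1) k₂ ℝ)
    (N : Matrix n (Fin ℓ) ℝ) (X : Matrix (Fin ℓ ⊕ n) (Fin ℓ ⊕ n) ℝ) (Y : Matrix n n ℝ)
    (lam : Fin (ℓ + 1) → ℝ) : Prop where
  primal : NegDef ((primalFactor ρ H Cperp lam)ᵀ * middle X (-X) * primalFactor ρ H Cperp lam)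
  dual : (dualFactor ρ μ L H Vt lam N * middle Y (-((ρ ^ 2)⁻¹ • Y)) *
    (dualFactor ρ μ L H Vt lam N)ᵀ).PosDef
  coupling : (fromBlocks Y (tildeT ρ μ L H lam N) (tildeT ρ μ L H lam N)ᵀ X).PosDef

end synthesis

/-- The set of all unknowns `(N, X̂, Ỹ, λ)` that are admissible for the synthesis problem. -/
def synthesisSet {n k₁ k₂ : Type} [Fintype n] [DecidableEq n]
    (ρ μ L : ℝ) (ℓ : ℕ) (H : LTI n)
    (Cperp : Matrix n k₁ ℝ) (Vt : Matrix (n ⊕ Fin 1) k₂ ℝ) :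
    Set (Matrix n (Fin ℓ) ℝ × Matrix (Fin ℓ ⊕ n) (Fin ℓ ⊕ n) ℝ × Matrix n n ℝ ×
      (Fin (ℓ + 1) → ℝ)) :=
  {q | q.2.1.IsSymm ∧ q.2.2.1.IsSymm ∧ q.2.2.2 ∈ zfParams ρ ℓ ∧
    Sylvester ρ μ H q.2.2.2 q.1 ∧
    SynthesisLMI ρ μ L H Cperp Vt q.1 q.2.1 q.2.2.1 q.2.2.2}

end TVOpt

end

noncomputable section

namespace TVOpt

/-! ### Quadratic forms -/

/-! The analysis LMI is a strict dissipation inequality for the loop formed by the filtered plant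
and the controller. With `Y = X⁻¹` and an auxiliary vector paired with the next state, the
controller enters through a single free bilinear term. The projection lemma (`exists_projection`)
trades this term for two controller-free inequalities: a primal one for the plant block of `X` on
the kernel of the measured output, and a dual one for the plant block of `X⁻¹` on the annihilator of
the control input. Conversely, plant-sized `X̂`, `Ŷ` with `[Ŷ I; I X̂] ≻ 0` extend to some `X` and
its inverse, at the price of a controller of plant order (`exists_certificate_completion`).

The full dual inequality contains products of `Ŷ` with `λ`. The Sylvester equation removes them:
`T̃` intertwines `Â` with `ρ⁻¹ A_p` up to a multiple of `B_p Ĉ_z`, and `T̃ B̂` is a multiple of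
`B_p`. Hence vectors `T̃ᵀ v`, paired with a suitable weight, satisfy the dual constraint and are
propagated by `v ↦ ρ⁻¹ A_pᵀ v`, so that on the range of `T̃ᵀ` only `T̃ Ŷ T̃ᵀ` matters and `λ` enters
linearly. The remaining `ℓ` directions decouple and follow the transposed zero dynamics of the
filter, which are stable by the Zames–Falb constraints.

For necessity take `Ỹ = T̃ Ŷ T̃ᵀ + ε I`. For sufficiency let `Ŷ` be `diag (t P, Ỹ)` in coordinates
adapted to `T̃ᵀ`, with `P` a Lyapunov matrix of the zero dynamics. Finsler's lemma
(`exists_forall_pos_add_mul`) yields a small `ε` and a large `t`.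

Both directions need `∑ λ_j ρ^j A_p^{-j}` to be invertible (`isUnit_filterEval`). The finite set `Ω`
contains all powers of its elements, so the harmonics are roots of unity; the transfer function
forces the characteristic polynomial of `A_p` to be `∏ (z - ω)`, whence `A_p ^ m = 1` for some `m >
0`.

The algorithm is the cascade of `H` and `K`. While its output vanishes, the certificate contracts by
`ρ²` per step; this gives detectability and a nonzero output at a fixed point, which exists because
`1 ∈ Ω`. Convexity holds because each constraint, tested on a fixed vector, is linear in the
unknowns. -/

theorem posDef_iff_real {n : Type*} [Fintype n] {M : Matrix n n ℝ} :
    M.PosDef ↔ M.IsSymm ∧ ∀ x, x ≠ 0 → 0 < x ⬝ᵥ M *ᵥ x := by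
  rw [Matrix.posDef_iff_dotProduct_mulVec, ← Matrix.isHermitian_iff_isSymm]
  simp

theorem PosDef.pos_of_ne_zero {n : Type*} [Fintype n] {M : Matrix n n ℝ} (h : M.PosDef)
    {x : n → ℝ} (hx : x ≠ 0) : 0 < x ⬝ᵥ M *ᵥ x :=
  (posDef_iff_real.1 h).2 x hx

theorem PosDef.isSymm_real {n : Type*} [Fintype n] {M : Matrix n n ℝ} (h : M.PosDef) :
    M.IsSymm :=
  (posDef_iff_real.1 h).1

theorem PosDef.nonneg {n : Type*} [Fintype n] {M : Matrix n n ℝ} (h : M.PosDef)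
    (x : n → ℝ) : 0 ≤ x ⬝ᵥ M *ᵥ x := by
  by_cases hx : x = 0
  · simp [hx]
  · exact (PosDef.pos_of_ne_zero h hx).le

theorem PosDef.of_isSymm {n : Type*} [Fintype n] {M : Matrix n n ℝ} (h : M.IsSymm)
    (hM : ∀ x, x ≠ 0 → 0 < x ⬝ᵥ M *ᵥ x) : M.PosDef :=
  posDef_iff_real.2 ⟨h, hM⟩

theorem negDef_iff {n : Type} [Fintype n] {M : Matrix n n ℝ} :
    NegDef M ↔ M.IsSymm ∧ ∀ x, x ≠ 0 → x ⬝ᵥ M *ᵥ x < 0 := by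
  unfold NegDef
  rw [posDef_iff_real]
  refine and_congr ?_ ?_
  · simp [Matrix.IsSymm]
  · simp [Matrix.neg_mulVec]

theorem IsSymm.dotProduct_comm {n : Type*} [Fintype n] {M : Matrix n n ℝ} (h : M.IsSymm)
    (x y : n → ℝ) : x ⬝ᵥ M *ᵥ y = y ⬝ᵥ M *ᵥ x := by
  rw [Matrix.dotProduct_mulVec, ← Matrix.mulVec_transpose, h.eq, _root_.dotProduct_comm]

theorem IsSymm.quad_add {n : Type*} [Fintype n] {M : Matrix n n ℝ} (h : M.IsSymm)
    (x y : n → ℝ) :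
    (x + y) ⬝ᵥ M *ᵥ (x + y) = x ⬝ᵥ M *ᵥ x + 2 * (x ⬝ᵥ M *ᵥ y) + y ⬝ᵥ M *ᵥ y := by
  rw [Matrix.mulVec_add, add_dotProduct, dotProduct_add, dotProduct_add,
    IsSymm.dotProduct_comm h y x]
  ring

/-- Finsler's lemma for functions that are homogeneous of degree two. -/
theorem exists_forall_pos_add_mul {E : Type*} [NormedAddCommGroup E] [NormedSpace ℝ E]
    [FiniteDimensional ℝ E] {f g : E → ℝ} (hf : Continuous f) (hg : Continuous g)
    (hf2 : ∀ (c : ℝ) x, f (c • x) = c ^ 2 * f x) (hg2 : ∀ (c : ℝ) x, g (c • x) = c ^ 2 * g x)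
    (hg0 : ∀ x, 0 ≤ g x) (h : ∀ x, x ≠ 0 → g x = 0 → 0 < f x) :
    ∃ t₀ : ℝ, ∀ t, t₀ ≤ t → ∀ x, x ≠ 0 → 0 < f x + t * g x := by
  have : ProperSpace E := FiniteDimensional.proper ℝ E
  -- The sets of failure on the unit sphere are compact and, as `g ≥ 0`, decreasing. A common point
  -- would contradict `f > 0` if `g` vanishes there, and `f + n g ≤ 0` for large `n` if it does not.
  let Z : ℕ → Set E := fun n => {x | x ∈ Metric.sphere (0 : E) 1 ∧ f x + n * g x ≤ 0}
  have hZ : ∃ n, Z n = ∅ := by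
    by_contra! hne
    have hcl : ∀ n, IsClosed (Z n) := fun n =>
      Metric.isClosed_sphere.inter (isClosed_le (hf.add (continuous_const.mul hg)) continuous_const)
    obtain ⟨x, hx⟩ := IsCompact.nonempty_iInter_of_sequence_nonempty_isCompact_isClosed Z
      (fun n x hx => ⟨hx.1, by
        have h1 := hx.2
        push_cast at h1
        nlinarith [hg0 x]⟩) hne
      ((isCompact_sphere (0 : E) 1).of_isClosed_subset (hcl 0) fun x hx => hx.1) hcl
    rw [Set.mem_iInter] at hx
    have hx0 : x ≠ 0 := by
      rintro rfl
      simpa using (hx 0).1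
    rcases (hg0 x).eq_or_lt with hgx | hgx
    · have := h x hx0 hgx.symm
      have h0 := (hx 0).2
      rw [← hgx] at h0
      linarith
    · obtain ⟨n, hn⟩ := exists_nat_gt (-f x / g x)
      rw [div_lt_iff₀ hgx] at hn
      linarith [(hx n).2]
  obtain ⟨n, hn⟩ := hZ
  refine ⟨n, fun t ht x hx => ?_⟩
  have hnx : 0 < ‖x‖ := norm_pos_iff.2 hx
  have h1 : 0 < f (‖x‖⁻¹ • x) + n * g (‖x‖⁻¹ • x) := by
    by_contra! hle
    have : ‖x‖⁻¹ • x ∈ Z n := ⟨by simp [norm_smul, hnx.ne'], hle⟩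
    simp [hn] at this
  rw [hf2, hg2] at h1
  have h2 : 0 < ‖x‖⁻¹ ^ 2 * (f x + n * g x) := by linarith
  have h3 : 0 < f x + n * g x := pos_of_mul_pos_right h2 (by positivity)
  nlinarith [hg0 x]

/-- The projection lemma. -/
theorem exists_projection {e a b : Type*} [Fintype e] [Fintype a] [Fintype b] [DecidableEq e]
    [DecidableEq a] [DecidableEq b]
    {Q : Matrix e e ℝ} (hQ : Q.IsSymm) (U : Matrix a e ℝ) (V : Matrix b e ℝ)
    (hU : ∀ x, x ≠ 0 → U *ᵥ x = 0 → x ⬝ᵥ Q *ᵥ x < 0)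
    (hV : ∀ x, x ≠ 0 → V *ᵥ x = 0 → x ⬝ᵥ Q *ᵥ x < 0) :
    ∃ K : Matrix a b ℝ, ∀ x, x ≠ 0 →
      x ⬝ᵥ Q *ᵥ x + 2 * ((U *ᵥ x) ⬝ᵥ (K *ᵥ (V *ᵥ x))) < 0 := by
  obtain ⟨t₀, ht₀⟩ := exists_forall_pos_add_mul (E := e → ℝ)
    (f := fun x => -(x ⬝ᵥ Q *ᵥ x)) (g := fun x => (U *ᵥ x) ⬝ᵥ (U *ᵥ x))
    (by fun_prop) (by fun_prop)
    (by intro c x; simp [mulVec_smul]; ring) (by intro c x; simp [mulVec_smul]; ring)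
    (fun x => by simpa using dotProduct_star_self_nonneg (U *ᵥ x))
    (fun x hx hx2 => by
      have := hU x hx (by simpa using hx2)
      simpa using this)
  -- Finsler on `ker U` makes `G = σ UᵀU - Q` positive definite; `σ ≥ 0` is needed at the end.
  set σ : ℝ := max t₀ 0 with hσ
  have hσ0 : 0 ≤ σ := le_max_right _ _
  set G : Matrix e e ℝ := σ • (Uᵀ * U) - Q with hG
  have hGs : G.IsSymm := by
    simp [hG, Matrix.IsSymm, transpose_sub, hQ.eq]
  have hGq : ∀ x y, x ⬝ᵥ G *ᵥ y = σ * ((U *ᵥ x) ⬝ᵥ (U *ᵥ y)) - x ⬝ᵥ Q *ᵥ y := by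
    intro x y
    simp only [hG, sub_mulVec, dotProduct_sub, smul_mulVec, dotProduct_smul, smul_eq_mul]
    rw [← mulVec_mulVec, dotProduct_mulVec x, ← mulVec_transpose, transpose_transpose]
  have hGpos : ∀ x, x ≠ 0 → 0 < x ⬝ᵥ G *ᵥ x := by
    intro x hx
    have := ht₀ σ (le_max_left _ _) x hx
    rw [hGq]
    linarith
  let B : LinearMap.BilinForm ℝ (e → ℝ) := Matrix.toBilin' G
  have hB : ∀ x y, B x y = x ⬝ᵥ G *ᵥ y := fun x y => Matrix.toBilin'_apply' G x y
  have hBs : B.IsSymm := ⟨fun x y => by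
    simp [hB, IsSymm.dotProduct_comm hGs x y]⟩
  set W : Submodule ℝ (e → ℝ) := LinearMap.ker V.mulVecLin with hW
  -- Split along `ker V` and its `G`-orthogonal complement. `V` is injective on the complement, so
  -- `V x` determines the component `x₁` there.
  have hcompl : IsCompl W (B.orthogonal W) := by
    rw [LinearMap.BilinForm.isCompl_orthogonal_iff_disjoint hBs.isRefl]
    rw [Submodule.disjoint_def]
    intro x hx hx2
    by_contra hne
    have := hx2 x hx
    replace this : B x x = 0 := this
    rw [hB] at this
    exact (hGpos x hne).ne' this
  obtain ⟨g, hg⟩ := LinearMap.exists_leftInverse_of_injective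
    (V.mulVecLin ∘ₗ (B.orthogonal W).subtype) (by
      rw [LinearMap.ker_eq_bot']
      rintro ⟨x, hx⟩ hx2
      have hxW : x ∈ W := by simpa [hW] using hx2
      have := (Submodule.disjoint_def.1 hcompl.disjoint) x hxW hx
      simpa using this)
  -- `K` sends `V x` to `-σ U x₁`. Since `x₀` and `x₁` are `G`-orthogonal, the form collapses to
  -- `Q(x₀) - G(x₁) - σ |U x₁|²`.
  refine ⟨LinearMap.toMatrix' ((-σ) • (U.mulVecLin ∘ₗ (B.orthogonal W).subtype ∘ₗ g)), ?_⟩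
  intro x hx
  obtain ⟨x₀, hx₀, x₁, hx₁, rfl⟩ := Submodule.mem_sup.1 (hcompl.sup_eq_top ▸ Submodule.mem_top : x ∈ _)
  have hVx : V *ᵥ (x₀ + x₁) = V *ᵥ x₁ := by
    have : V *ᵥ x₀ = 0 := by simpa [hW] using hx₀
    rw [mulVec_add, this, zero_add]
  have hgx : g (V *ᵥ x₁) = ⟨x₁, hx₁⟩ := by
    simpa using LinearMap.congr_fun hg ⟨x₁, hx₁⟩
  have hort : x₀ ⬝ᵥ G *ᵥ x₁ = 0 := by
    have : B x₀ x₁ = 0 := hx₁ x₀ hx₀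
    rwa [hB] at this
  rw [hVx, LinearMap.toMatrix'_mulVec]
  simp only [LinearMap.smul_apply, LinearMap.comp_apply, hgx, Submodule.subtype_apply,
    mulVecLin_apply, dotProduct_smul, smul_eq_mul]
  rw [IsSymm.quad_add hQ, mulVec_add, add_dotProduct]
  rw [hGq] at hort
  have h11 := hGq x₁ x₁
  have hUU : 0 ≤ (U *ᵥ x₁) ⬝ᵥ (U *ᵥ x₁) := by simpa using dotProduct_star_self_nonneg (U *ᵥ x₁)
  have hmul := mul_nonneg hσ0 hUU
  by_cases h0 : x₀ = 0
  · have hne : x₁ ≠ 0 := by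
      rintro rfl
      simp [h0] at hx
    have := hGpos x₁ hne
    subst h0
    simp at hort ⊢
    linarith
  · have h1 := hV x₀ h0 (by simpa [hW] using hx₀)
    have h2 : 0 ≤ x₁ ⬝ᵥ G *ᵥ x₁ := by
      by_cases h : x₁ = 0
      · simp [h]
      · exact (hGpos x₁ h).le
    linarith


/-! ### Block vectors and the quadratic forms of the LMIs -/

theorem fromRows_mulVec_elim {m₁ m₂ n : Type*} [Fintype n] (A : Matrix m₁ n ℝ)
    (B : Matrix m₂ n ℝ) (x : n → ℝ) :
    fromRows A B *ᵥ x = Sum.elim (A *ᵥ x) (B *ᵥ x) := by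
  ext (i | i) <;> rfl

theorem fromCols_mulVec_elim {m n₁ n₂ : Type*} [Fintype n₁] [Fintype n₂] (A : Matrix m n₁ ℝ)
    (B : Matrix m n₂ ℝ) (x : n₁ → ℝ) (y : n₂ → ℝ) :
    fromCols A B *ᵥ Sum.elim x y = A *ᵥ x + B *ᵥ y := by
  ext i
  simp [mulVec, dotProduct]

theorem fromBlocks_mulVec_elim {m₁ m₂ n₁ n₂ : Type*} [Fintype n₁] [Fintype n₂]
    (A : Matrix m₁ n₁ ℝ) (B : Matrix m₁ n₂ ℝ) (C : Matrix m₂ n₁ ℝ) (D : Matrix m₂ n₂ ℝ)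
    (x : n₁ → ℝ) (y : n₂ → ℝ) :
    fromBlocks A B C D *ᵥ Sum.elim x y = Sum.elim (A *ᵥ x + B *ᵥ y) (C *ᵥ x + D *ᵥ y) := by
  rw [fromBlocks_mulVec]
  rfl

theorem forall_sum_elim {m n : Type*} {P : (m ⊕ n → ℝ) → Prop} :
    (∀ x, P x) ↔ ∀ x y, P (Sum.elim x y) :=
  ⟨fun h x y => h _, fun h x => by simpa using h (x ∘ Sum.inl) (x ∘ Sum.inr)⟩

theorem sum_elim_ne_zero {m n : Type*} {x : m → ℝ} {y : n → ℝ} :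
    Sum.elim x y ≠ 0 ↔ (x ≠ 0 ∨ y ≠ 0) := by
  rw [← not_and_or, not_iff_not]
  constructor
  · intro h
    exact ⟨funext fun i => congrFun h (Sum.inl i), funext fun i => congrFun h (Sum.inr i)⟩
  · rintro ⟨rfl, rfl⟩
    ext (i | i) <;> rfl

theorem quad_congr {m n : Type*} [Fintype m] [Fintype n] (W : Matrix m n ℝ) (M : Matrix m m ℝ)
    (x y : n → ℝ) : x ⬝ᵥ (Wᵀ * M * W) *ᵥ y = (W *ᵥ x) ⬝ᵥ M *ᵥ (W *ᵥ y) := by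
  rw [← mulVec_mulVec, ← mulVec_mulVec, dotProduct_mulVec, ← mulVec_transpose, transpose_transpose]

theorem transpose_dot {m n : Type*} [Fintype m] [Fintype n] (W : Matrix m n ℝ)
    (x : m → ℝ) (y : n → ℝ) : (Wᵀ *ᵥ x) ⬝ᵥ y = x ⬝ᵥ W *ᵥ y := by
  rw [dotProduct_mulVec, mulVec_transpose]

theorem isSymm_congr {m n : Type*} [Fintype m] {M : Matrix m m ℝ} (hM : M.IsSymm)
    (W : Matrix m n ℝ) : (Wᵀ * M * W).IsSymm := by
  simp [Matrix.IsSymm, transpose_mul, hM.eq, Matrix.mul_assoc]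

theorem toBlocks₁₁_quad {s c : Type*} [Fintype s] [Fintype c] (X : Matrix (s ⊕ c) (s ⊕ c) ℝ)
    (a : s → ℝ) :
    Sum.elim a (0 : c → ℝ) ⬝ᵥ X *ᵥ Sum.elim a 0 = a ⬝ᵥ X.toBlocks₁₁ *ᵥ a := by
  conv_lhs => rw [← fromBlocks_toBlocks X]
  simp [fromBlocks_mulVec_elim, sumElim_dotProduct_sumElim]

theorem middle_isSymm {n : Type} {X Y : Matrix n n ℝ} (hX : X.IsSymm) (hY : Y.IsSymm) :
    (middle X Y).IsSymm := by
  simp [middle, Matrix.IsSymm, fromBlocks_transpose, hX.eq, hY.eq]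

theorem middle_quad {n : Type} [Fintype n] (X Y : Matrix n n ℝ) (s x : n → ℝ)
    (r q : Fin 1 → ℝ) :
    Sum.elim (Sum.elim s x) (Sum.elim r q) ⬝ᵥ
      middle X Y *ᵥ Sum.elim (Sum.elim s x) (Sum.elim r q) =
    s ⬝ᵥ X *ᵥ s + x ⬝ᵥ Y *ᵥ x + 2 * (q ⬝ᵥ r) := by
  simp only [middle, fromBlocks_mulVec_elim, sumElim_dotProduct_sumElim, zero_mulVec, add_zero,
    zero_add, one_mulVec]
  rw [_root_.dotProduct_comm r q]
  ring

theorem outer_mulVec {n : Type} [Fintype n] [DecidableEq n] (A : Matrix n n ℝ)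
    (B : Matrix n (Fin 1) ℝ) (C : Matrix (Fin 1) n ℝ) (D : Matrix (Fin 1) (Fin 1) ℝ)
    (x : n → ℝ) (q : Fin 1 → ℝ) :
    outer A B C D *ᵥ Sum.elim x q =
      Sum.elim (Sum.elim (A *ᵥ x + B *ᵥ q) x) (Sum.elim (C *ᵥ x + D *ᵥ q) q) := by
  simp [outer, fromBlocks_mulVec_elim]

theorem outer_quad {n : Type} [Fintype n] [DecidableEq n] (A : Matrix n n ℝ)
    (B : Matrix n (Fin 1) ℝ) (C : Matrix (Fin 1) n ℝ) (D : Matrix (Fin 1) (Fin 1) ℝ)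
    (X : Matrix n n ℝ) (x : n → ℝ) (q : Fin 1 → ℝ) :
    (outer A B C D *ᵥ Sum.elim x q) ⬝ᵥ middle X (-X) *ᵥ (outer A B C D *ᵥ Sum.elim x q) =
      (A *ᵥ x + B *ᵥ q) ⬝ᵥ X *ᵥ (A *ᵥ x + B *ᵥ q) - x ⬝ᵥ X *ᵥ x
        + 2 * (q ⬝ᵥ (C *ᵥ x + D *ᵥ q)) := by
  rw [outer_mulVec, middle_quad]
  simp [neg_mulVec]
  ring

/-- This is the dissipation form in which the LMI is used: storage `xᵀ X x`, supply given by the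
product of `q` and the output. -/
theorem analysisLMI_iff {n : Type} [Fintype n] [DecidableEq n] (G : LTI n) (X : Matrix n n ℝ) :
    AnalysisLMI G X ↔ X.PosDef ∧ ∀ x q, (x ≠ 0 ∨ q ≠ 0) →
      (G.A *ᵥ x + G.B *ᵥ q) ⬝ᵥ X *ᵥ (G.A *ᵥ x + G.B *ᵥ q) - x ⬝ᵥ X *ᵥ x
        + 2 * (q ⬝ᵥ (G.C *ᵥ x + G.D *ᵥ q)) < 0 := by
  unfold AnalysisLMI
  refine and_congr_right fun hX => ?_
  have hs := PosDef.isSymm_real hX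
  rw [negDef_iff, and_iff_right (isSymm_congr (middle_isSymm hs (by simpa [Matrix.IsSymm] using hs)) _),
    forall_sum_elim]
  simp only [quad_congr, outer_quad, sum_elim_ne_zero]

/-! ### Elimination of the controller -/

/-- A plant with disturbance channel `q ↦ r` and control channel `u ↦ y`. -/
structure Plant (s u y : Type) where
  A : Matrix s s ℝ
  Bw : Matrix s (Fin 1) ℝ
  B : Matrix s u ℝ
  Cz : Matrix (Fin 1) s ℝ
  Dzw : Matrix (Fin 1) (Fin 1) ℝ
  Dz : Matrix (Fin 1) u ℝ
  C : Matrix y s ℝ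

/-- The interconnection of a plant with the controller `(Ac, Bc, Cc, Dc)`. -/
def Plant.close {s c u y : Type} [Fintype u] [Fintype y] (P : Plant s u y) (Ac : Matrix c c ℝ)
    (Bc : Matrix c y ℝ) (Cc : Matrix u c ℝ) (Dc : Matrix u y ℝ) : LTI (s ⊕ c) where
  A := fromBlocks (P.A + P.B * Dc * P.C) (P.B * Cc) (Bc * P.C) Ac
  B := fromRows P.Bw 0
  C := fromCols (P.Cz + P.Dz * Dc * P.C) (P.Dz * Cc)
  D := P.Dzw

section elimination

variable {s c u y : Type} [Fintype s] [Fintype c] [Fintype u] [Fintype y]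

/-- The dissipation inequality on the kernel of the measured output. -/
def Plant.Primal (P : Plant s u y) (X : Matrix s s ℝ) : Prop :=
  ∀ x q, (x ≠ 0 ∨ q ≠ 0) → P.C *ᵥ x = 0 →
    (P.A *ᵥ x + P.Bw *ᵥ q) ⬝ᵥ X *ᵥ (P.A *ᵥ x + P.Bw *ᵥ q) - x ⬝ᵥ X *ᵥ x
      + 2 * (q ⬝ᵥ (P.Cz *ᵥ x + P.Dzw *ᵥ q)) < 0

/-- The dual dissipation inequality on the annihilator of the control input. -/
def Plant.Dual (P : Plant s u y) (Y : Matrix s s ℝ) : Prop :=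
  ∀ a q, (a ≠ 0 ∨ q ≠ 0) → P.Bᵀ *ᵥ a + P.Dzᵀ *ᵥ q = 0 →
    (P.Aᵀ *ᵥ a + P.Czᵀ *ᵥ q) ⬝ᵥ Y *ᵥ (P.Aᵀ *ᵥ a + P.Czᵀ *ᵥ q) - a ⬝ᵥ Y *ᵥ a
      + 2 * (q ⬝ᵥ (P.Bwᵀ *ᵥ a + P.Dzw *ᵥ q)) < 0

theorem Plant.close_A_mulVec (P : Plant s u y) (Ac : Matrix c c ℝ)
    (Bc : Matrix c y ℝ) (Cc : Matrix u c ℝ) (Dc : Matrix u y ℝ) (x : s → ℝ) (xc : c → ℝ)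
    (q : Fin 1 → ℝ) :
    (P.close Ac Bc Cc Dc).A *ᵥ Sum.elim x xc + (P.close Ac Bc Cc Dc).B *ᵥ q =
      Sum.elim (P.A *ᵥ x + P.Bw *ᵥ q + P.B *ᵥ (Dc *ᵥ (P.C *ᵥ x) + Cc *ᵥ xc))
        (Bc *ᵥ (P.C *ᵥ x) + Ac *ᵥ xc) := by
  simp only [Plant.close, fromBlocks_mulVec_elim, fromRows_mulVec_elim, add_mulVec, mulVec_mulVec,
    mulVec_add, zero_mulVec, Matrix.mul_assoc]
  ext (i | i)
  · simp; ring
  · simp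

theorem Plant.close_C_mulVec (P : Plant s u y) (Ac : Matrix c c ℝ)
    (Bc : Matrix c y ℝ) (Cc : Matrix u c ℝ) (Dc : Matrix u y ℝ) (x : s → ℝ) (xc : c → ℝ)
    (q : Fin 1 → ℝ) :
    (P.close Ac Bc Cc Dc).C *ᵥ Sum.elim x xc + (P.close Ac Bc Cc Dc).D *ᵥ q =
      P.Cz *ᵥ x + P.Dzw *ᵥ q + P.Dz *ᵥ (Dc *ᵥ (P.C *ᵥ x) + Cc *ᵥ xc) := by
  simp only [Plant.close, fromCols_mulVec_elim, add_mulVec, mulVec_mulVec,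
    mulVec_add, Matrix.mul_assoc]
  abel

/-- Completion of squares. -/
theorem two_mul_dot_le {n : Type*} [Fintype n] [DecidableEq n] {X Y : Matrix n n ℝ}
    (hY : Y.PosDef) (hYX : Y * X = 1) (p s : n → ℝ) :
    2 * (p ⬝ᵥ s) ≤ p ⬝ᵥ Y *ᵥ p + s ⬝ᵥ X *ᵥ s := by
  have h1 := PosDef.nonneg hY (p + -(X *ᵥ s))
  rw [IsSymm.quad_add (PosDef.isSymm_real hY)] at h1
  simp only [mulVec_neg, dotProduct_neg, neg_dotProduct, mulVec_mulVec, hYX, one_mulVec] at h1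
  rw [_root_.dotProduct_comm (X *ᵥ s) s] at h1
  linarith

/-- Equality case in the completion of squares. -/
theorem quad_mulVec_self {n : Type*} [Fintype n] [DecidableEq n] {X Y : Matrix n n ℝ}
    (hYX : Y * X = 1) (s : n → ℝ) :
    (X *ᵥ s) ⬝ᵥ Y *ᵥ (X *ᵥ s) = s ⬝ᵥ X *ᵥ s := by
  rw [mulVec_mulVec, hYX, one_mulVec, _root_.dotProduct_comm]

/-- Existence of a controller from the primal and dual inequalities. -/
theorem Plant.exists_controller [DecidableEq s] [DecidableEq c] [DecidableEq u] [DecidableEq y]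
    (P : Plant s u y) {X Y : Matrix (s ⊕ c) (s ⊕ c) ℝ} (hX : X.PosDef) (hY : Y.PosDef)
    (hYX : Y * X = 1) (hprimal : P.Primal X.toBlocks₁₁) (hdual : P.Dual Y.toBlocks₁₁) :
    ∃ (Ac : Matrix c c ℝ) (Bc : Matrix c y ℝ) (Cc : Matrix u c ℝ) (Dc : Matrix u y ℝ),
      AnalysisLMI (P.close Ac Bc Cc Dc) X := by
  have hXs := PosDef.isSymm_real hX
  have hYs := PosDef.isSymm_real hY
  have hXY : X * Y = 1 := mul_eq_one_comm.1 hYX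
  let A₀ : Matrix (s ⊕ c) (s ⊕ c) ℝ := fromBlocks P.A 0 0 0
  let B₀ : Matrix (s ⊕ c) (Fin 1) ℝ := fromRows P.Bw 0
  let C₀ : Matrix (Fin 1) (s ⊕ c) ℝ := fromCols P.Cz 0
  -- The variables are the state, `q` and a vector `p` paired with the next state; maximizing `2 p·z
  -- - pᵀ Y p` over `p` restores the storage `zᵀ X z`. The controller blocks enter only through `2
  -- (U ·)·K (V ·)`.
  let Q : Matrix ((s ⊕ c) ⊕ (Fin 1 ⊕ (s ⊕ c))) ((s ⊕ c) ⊕ (Fin 1 ⊕ (s ⊕ c))) ℝ :=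
    fromBlocks (-X) (fromCols C₀ᵀ A₀ᵀ) (fromRows C₀ A₀) (fromBlocks (P.Dzw + P.Dzwᵀ) B₀ᵀ B₀ (-Y))
  let U : Matrix (c ⊕ u) ((s ⊕ c) ⊕ (Fin 1 ⊕ (s ⊕ c))) ℝ :=
    fromCols 0 (fromCols (fromRows 0 P.Dzᵀ) (fromBlocks 0 1 P.Bᵀ 0))
  let V : Matrix (c ⊕ y) ((s ⊕ c) ⊕ (Fin 1 ⊕ (s ⊕ c))) ℝ :=
    fromCols (fromBlocks 0 1 P.C 0) 0
  have hQs : Q.IsSymm := by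
    simp [Q, Matrix.IsSymm, fromBlocks_transpose, transpose_fromRows, transpose_fromCols, hXs.eq,
      hYs.eq, add_comm]
  have hQq : ∀ (x : s ⊕ c → ℝ) q p, Sum.elim x (Sum.elim q p) ⬝ᵥ Q *ᵥ Sum.elim x (Sum.elim q p)
      = -(x ⬝ᵥ X *ᵥ x) + 2 * (q ⬝ᵥ (C₀ *ᵥ x + P.Dzw *ᵥ q)) + 2 * (p ⬝ᵥ (A₀ *ᵥ x + B₀ *ᵥ q))
        - p ⬝ᵥ Y *ᵥ p := by
    intro x q p
    simp only [Q, fromBlocks_mulVec_elim, fromRows_mulVec_elim, fromCols_mulVec_elim,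
      sumElim_dotProduct_sumElim, dotProduct_add, neg_mulVec, dotProduct_neg, add_mulVec]
    have h1 : x ⬝ᵥ C₀ᵀ *ᵥ q = q ⬝ᵥ C₀ *ᵥ x := by rw [_root_.dotProduct_comm, transpose_dot]
    have h2 : x ⬝ᵥ A₀ᵀ *ᵥ p = p ⬝ᵥ A₀ *ᵥ x := by rw [_root_.dotProduct_comm, transpose_dot]
    have h3 : q ⬝ᵥ B₀ᵀ *ᵥ p = p ⬝ᵥ B₀ *ᵥ q := by rw [_root_.dotProduct_comm, transpose_dot]
    have h4 : q ⬝ᵥ P.Dzwᵀ *ᵥ q = q ⬝ᵥ P.Dzw *ᵥ q := by rw [_root_.dotProduct_comm, transpose_dot]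
    rw [h1, h2, h3, h4]
    ring
  have hUe : ∀ (x : s ⊕ c → ℝ) q p₁ p₂, U *ᵥ Sum.elim x (Sum.elim q (Sum.elim p₁ p₂)) =
      Sum.elim p₂ (P.Bᵀ *ᵥ p₁ + P.Dzᵀ *ᵥ q) := by
    intro x q p₁ p₂
    simp only [U, fromBlocks_mulVec_elim, fromRows_mulVec_elim, fromCols_mulVec_elim, zero_mulVec,
      one_mulVec]
    ext (i | i)
    · simp
    · simp [add_comm]
  have hVe : ∀ (x : s → ℝ) (xc : c → ℝ) q,
      V *ᵥ Sum.elim (Sum.elim x xc) q = Sum.elim xc (P.C *ᵥ x) := by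
    intro x xc q
    simp only [V, fromBlocks_mulVec_elim, fromCols_mulVec_elim, zero_mulVec, one_mulVec,
      zero_add, add_zero]
  have hX11 := toBlocks₁₁_quad (s := s) (c := c) X
  have hY11 := toBlocks₁₁_quad (s := s) (c := c) Y
  -- On `ker U` completing the square in the state leaves the dual inequality; on `ker V` completing
  -- it in `p` leaves the primal one.
  obtain ⟨K, hK⟩ := exists_projection hQs U V
    (by
      simp only [forall_sum_elim, hUe, hQq]
      intro x xc q p₁ p₂ hne h0
      have hp₂ : p₂ = 0 := funext fun i => congrFun h0 (Sum.inl i)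
      have hb : P.Bᵀ *ᵥ p₁ + P.Dzᵀ *ᵥ q = 0 := funext fun i => congrFun h0 (Sum.inr i)
      subst hp₂
      have hsq := two_mul_dot_le hX hXY (Sum.elim x xc)
        (Sum.elim (P.Aᵀ *ᵥ p₁ + P.Czᵀ *ᵥ q) 0)
      rw [hY11, sumElim_dotProduct_sumElim] at hsq
      rw [hY11]
      simp only [A₀, B₀, C₀, fromBlocks_mulVec_elim, fromRows_mulVec_elim, fromCols_mulVec_elim,
        zero_mulVec, add_zero, sumElim_dotProduct_sumElim, dotProduct_add,
        dotProduct_zero]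
      have h2 : x ⬝ᵥ (P.Aᵀ *ᵥ p₁ + P.Czᵀ *ᵥ q) = p₁ ⬝ᵥ P.A *ᵥ x + q ⬝ᵥ P.Cz *ᵥ x := by
        rw [_root_.dotProduct_comm, add_dotProduct, transpose_dot, transpose_dot]
      have h3 : q ⬝ᵥ P.Bwᵀ *ᵥ p₁ = p₁ ⬝ᵥ P.Bw *ᵥ q := by
        rw [_root_.dotProduct_comm, transpose_dot]
      rw [h2, dotProduct_zero] at hsq
      by_cases hpq : p₁ ≠ 0 ∨ q ≠ 0
      · have := hdual p₁ q hpq hb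
        rw [dotProduct_add q, h3] at this
        linarith
      · push Not at hpq
        obtain ⟨rfl, rfl⟩ := hpq
        have hx : Sum.elim x xc ≠ 0 := by
          intro h
          apply hne
          rw [h]
          ext (i | i | i | i) <;> simp
        have := PosDef.pos_of_ne_zero hX hx
        simp only [zero_dotProduct]
        linarith)
    (by
      simp only [forall_sum_elim, hVe, hQq]
      intro x xc q p₁ p₂ hne h0
      have hxc : xc = 0 := funext fun i => congrFun h0 (Sum.inl i)
      have hb : P.C *ᵥ x = 0 := funext fun i => congrFun h0 (Sum.inr i)
      subst hxc
      have hsq := two_mul_dot_le hY hYX (Sum.elim p₁ p₂)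
        (A₀ *ᵥ Sum.elim x 0 + B₀ *ᵥ q)
      have hAB : A₀ *ᵥ Sum.elim x 0 + B₀ *ᵥ q = Sum.elim (P.A *ᵥ x + P.Bw *ᵥ q) 0 := by
        simp only [A₀, B₀, fromBlocks_mulVec_elim, fromRows_mulVec_elim,
          zero_mulVec, add_zero]
        ext (i | i) <;> simp
      have hC : C₀ *ᵥ Sum.elim x 0 = P.Cz *ᵥ x := by
        simp [C₀]
      rw [hAB, hX11] at hsq
      rw [hAB, hC, hX11]
      by_cases hpq : x ≠ 0 ∨ q ≠ 0
      · have := hprimal x q hpq hb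
        linarith
      · push Not at hpq
        obtain ⟨rfl, rfl⟩ := hpq
        have hx : Sum.elim p₁ p₂ ≠ 0 := by
          intro h
          apply hne
          rw [h]
          ext (i | i | i | i) <;> simp
        have := PosDef.pos_of_ne_zero hY hx
        have h00 : (Sum.elim (0 : s → ℝ) (0 : c → ℝ)) = 0 := by ext (i | i) <;> rfl
        simp [h00]
        linarith)
  refine ⟨K.toBlocks₁₁, K.toBlocks₁₂, K.toBlocks₂₁, K.toBlocks₂₂, ?_⟩
  rw [analysisLMI_iff]
  refine ⟨hX, ?_⟩
  rw [forall_sum_elim]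
  intro x xc q hne
  rw [Plant.close_A_mulVec, Plant.close_C_mulVec]
  set uu := K.toBlocks₂₂ *ᵥ (P.C *ᵥ x) + K.toBlocks₂₁ *ᵥ xc with huu
  set xp := K.toBlocks₁₂ *ᵥ (P.C *ᵥ x) + K.toBlocks₁₁ *ᵥ xc with hxp
  set z : s ⊕ c → ℝ := Sum.elim (P.A *ᵥ x + P.Bw *ᵥ q + P.B *ᵥ uu) xp with hz
  have hKm : K *ᵥ Sum.elim xc (P.C *ᵥ x) = Sum.elim xp uu := by
    conv_lhs => rw [← fromBlocks_toBlocks K]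
    rw [fromBlocks_mulVec_elim, hxp, huu, add_comm, add_comm (K.toBlocks₂₁ *ᵥ xc)]
  -- Insert the maximizer `p = X z`, where `z` is the next closed-loop state.
  have hmain := hK (Sum.elim (Sum.elim x xc) (Sum.elim q
    (Sum.elim ((X *ᵥ z) ∘ Sum.inl) ((X *ᵥ z) ∘ Sum.inr))))
    (by
      rw [sum_elim_ne_zero, sum_elim_ne_zero (x := q)]
      tauto)
  rw [hUe, hVe, hQq, hKm, Sum.elim_comp_inl_inr, quad_mulVec_self hYX] at hmain
  set p := X *ᵥ z with hp
  have hAB : A₀ *ᵥ Sum.elim x xc + B₀ *ᵥ q = Sum.elim (P.A *ᵥ x + P.Bw *ᵥ q) 0 := by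
    simp only [A₀, B₀, fromBlocks_mulVec_elim, fromRows_mulVec_elim,
      zero_mulVec, add_zero]
    ext (i | i) <;> simp
  have hC : C₀ *ᵥ Sum.elim x xc = P.Cz *ᵥ x := by
    simp [C₀]
  rw [hAB, hC] at hmain
  have hpz : z ⬝ᵥ p = (p ∘ Sum.inl) ⬝ᵥ (P.A *ᵥ x + P.Bw *ᵥ q) + (p ∘ Sum.inl) ⬝ᵥ P.B *ᵥ uu
      + (p ∘ Sum.inr) ⬝ᵥ xp := by
    rw [_root_.dotProduct_comm, hz]
    conv_lhs => rw [← Sum.elim_comp_inl_inr p]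
    rw [sumElim_dotProduct_sumElim, dotProduct_add]
  have hp0 : p ⬝ᵥ Sum.elim (P.A *ᵥ x + P.Bw *ᵥ q) 0 = (p ∘ Sum.inl) ⬝ᵥ (P.A *ᵥ x + P.Bw *ᵥ q) := by
    conv_lhs => rw [← Sum.elim_comp_inl_inr p]
    rw [sumElim_dotProduct_sumElim, dotProduct_zero, add_zero]
  rw [sumElim_dotProduct_sumElim, add_dotProduct, transpose_dot, transpose_dot, hp0] at hmain
  rw [dotProduct_add]
  linarith

/-- The primal inequality is necessary. -/
theorem Plant.primal_of_analysisLMI [DecidableEq s] [DecidableEq c]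
    (P : Plant s u y) {X : Matrix (s ⊕ c) (s ⊕ c) ℝ} {Ac : Matrix c c ℝ} {Bc : Matrix c y ℝ}
    {Cc : Matrix u c ℝ} {Dc : Matrix u y ℝ} (h : AnalysisLMI (P.close Ac Bc Cc Dc) X) :
    P.Primal X.toBlocks₁₁ := by
  intro x q hne hC
  have h1 := ((analysisLMI_iff _ _).1 h).2 (Sum.elim x 0) q (by
    rw [sum_elim_ne_zero]; tauto)
  rw [Plant.close_A_mulVec, Plant.close_C_mulVec, hC] at h1
  have hX11 := toBlocks₁₁_quad (s := s) (c := c) X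
  simpa [hX11] using h1

/-- The dual inequality is necessary. -/
theorem Plant.dual_of_analysisLMI [DecidableEq s] [DecidableEq c]
    (P : Plant s u y) {X : Matrix (s ⊕ c) (s ⊕ c) ℝ} {Ac : Matrix c c ℝ} {Bc : Matrix c y ℝ}
    {Cc : Matrix u c ℝ} {Dc : Matrix u y ℝ} (h : AnalysisLMI (P.close Ac Bc Cc Dc) X) :
    P.Dual X⁻¹.toBlocks₁₁ := by
  intro a q hne hB
  obtain ⟨hX, h⟩ := (analysisLMI_iff _ _).1 h
  have hY := hX.inv
  have hYX : X⁻¹ * X = 1 := nonsing_inv_mul _ ((isUnit_iff_isUnit_det _).1 hX.isUnit)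
  have hXY : X * X⁻¹ = 1 := mul_nonsing_inv _ ((isUnit_iff_isUnit_det _).1 hX.isUnit)
  set Y := X⁻¹ with hYdef
  have hXs := PosDef.isSymm_real hX
  have hYs := PosDef.isSymm_real hY
  have hY11 := toBlocks₁₁_quad (s := s) (c := c) Y
  set l := P.Aᵀ *ᵥ a + P.Czᵀ *ᵥ q with hl
  -- This test state has storage `lᵀ Y₁₁ l` and the same pairing with `l`. The next state is then
  -- bounded below by completing the square with `(a, 0)`, and the control terms cancel by the
  -- annihilator condition.
  set xx : s ⊕ c → ℝ := Y *ᵥ Sum.elim l 0 with hxx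
  have hxq : xx ⬝ᵥ X *ᵥ xx = l ⬝ᵥ Y.toBlocks₁₁ *ᵥ l := by
    rw [hxx, quad_mulVec_self hXY, hY11]
  obtain ⟨x, xc, hxe⟩ : ∃ x xc, xx = Sum.elim x xc :=
    ⟨xx ∘ Sum.inl, xx ∘ Sum.inr, (Sum.elim_comp_inl_inr _).symm⟩
  have hlx : l ⬝ᵥ x = l ⬝ᵥ Y.toBlocks₁₁ *ᵥ l := by
    rw [← hY11, ← hxx, hxe, sumElim_dotProduct_sumElim, zero_dotProduct, add_zero]
  rw [hl, add_dotProduct, transpose_dot, transpose_dot, ← hl] at hlx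
  have hsq := two_mul_dot_le hY hYX (Sum.elim a 0)
    ((P.close Ac Bc Cc Dc).A *ᵥ xx + (P.close Ac Bc Cc Dc).B *ᵥ q)
  have hBu : ∀ w, a ⬝ᵥ P.B *ᵥ w + q ⬝ᵥ P.Dz *ᵥ w = 0 := by
    intro w
    rw [← transpose_dot, ← transpose_dot, ← add_dotProduct, hB, zero_dotProduct]
  have h3 : q ⬝ᵥ P.Bwᵀ *ᵥ a = a ⬝ᵥ P.Bw *ᵥ q := by
    rw [_root_.dotProduct_comm, transpose_dot]
  -- The LMI is not strict at the zero vector; there strictness comes from `aᵀ Y₁₁ a > 0`.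
  by_cases hz : xx = 0 ∧ q = 0
  · obtain ⟨hx0, rfl⟩ := hz
    have ha : a ≠ 0 := by simpa using hne
    rw [hx0] at hxq
    have := PosDef.pos_of_ne_zero hY (x := Sum.elim a (0 : c → ℝ)) (by
      rw [sum_elim_ne_zero]; exact Or.inl ha)
    rw [hY11] at this
    rw [← hxq, zero_dotProduct, zero_dotProduct]
    linarith
  · have h1 := h xx q (by tauto)
    rw [hxq] at h1
    rw [hxe, Plant.close_A_mulVec] at hsq
    rw [hxe, Plant.close_A_mulVec, Plant.close_C_mulVec] at h1
    rw [hY11, sumElim_dotProduct_sumElim, zero_dotProduct] at hsq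
    have := hBu (Dc *ᵥ (P.C *ᵥ x) + Cc *ᵥ xc)
    simp only [dotProduct_add] at h1 hsq ⊢
    linarith

end elimination


/-- A primal and a dual certificate that satisfy the coupling condition can be completed to a
certificate and its inverse. -/
theorem exists_certificate_completion {s c : Type} [Fintype s] [Fintype c] [DecidableEq s]
    [DecidableEq c] (e : c ≃ s) {X Y : Matrix s s ℝ} (hX : X.IsSymm) (hY : Y.IsSymm)
    (h : ∀ a x : s → ℝ, (a ≠ 0 ∨ x ≠ 0) → 0 < a ⬝ᵥ Y *ᵥ a + 2 * (a ⬝ᵥ x) + x ⬝ᵥ X *ᵥ x) :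
    ∃ X' Y' : Matrix (s ⊕ c) (s ⊕ c) ℝ, X'.PosDef ∧ Y'.PosDef ∧ Y' * X' = 1 ∧
      X'.toBlocks₁₁ = X ∧ Y'.toBlocks₁₁ = Y := by
  have hYp : Y.PosDef := PosDef.of_isSymm hY fun a ha => by simpa using h a 0 (Or.inl ha)
  have hYu : IsUnit Y.det := (isUnit_iff_isUnit_det _).1 hYp.isUnit
  have hYis := PosDef.isSymm_real hYp.inv
  have hZs : (X - Y⁻¹).IsSymm := hX.sub hYis
  have hZp : (X - Y⁻¹).PosDef := by
    refine PosDef.of_isSymm hZs fun x hx => ?_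
    have h1 := h (-(Y⁻¹ *ᵥ x)) x (Or.inr hx)
    simp only [mulVec_neg, dotProduct_neg, neg_dotProduct, mulVec_mulVec, mul_nonsing_inv _ hYu,
      one_mulVec, neg_neg] at h1
    rw [_root_.dotProduct_comm (Y⁻¹ *ᵥ x) x] at h1
    rw [sub_mulVec, dotProduct_sub]
    linarith
  set Z := X - Y⁻¹ with hZ
  have hXe : X = Z + Y⁻¹ := by simp [hZ]
  have hZu : IsUnit Z.det := (isUnit_iff_isUnit_det _).1 hZp.isUnit
  -- Coupling makes `Z = X - Y⁻¹` positive definite, and the form of `X₀` is `xᵀ Y⁻¹ x + (x + y)ᵀ Z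
  -- (x + y)`.
  let X₀ : Matrix (s ⊕ s) (s ⊕ s) ℝ := fromBlocks X Z Z Z
  let Y₀ : Matrix (s ⊕ s) (s ⊕ s) ℝ := fromBlocks Y (-Y) (-Y) (Y + Z⁻¹)
  have hX₀ : X₀.PosDef := by
    refine PosDef.of_isSymm (by simp [X₀, Matrix.IsSymm, fromBlocks_transpose, hX.eq, hZs.eq]) ?_
    rw [forall_sum_elim]
    intro x y hne
    have hq : Sum.elim x y ⬝ᵥ X₀ *ᵥ Sum.elim x y =
        x ⬝ᵥ Y⁻¹ *ᵥ x + (x + y) ⬝ᵥ Z *ᵥ (x + y) := by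
      rw [IsSymm.quad_add hZs]
      simp only [X₀, fromBlocks_mulVec_elim, sumElim_dotProduct_sumElim, dotProduct_add]
      rw [IsSymm.dotProduct_comm hZs y x, hXe, add_mulVec, dotProduct_add]
      ring
    rw [hq]
    by_cases hx : x = 0
    · subst hx
      have hy : y ≠ 0 := by
        rintro rfl
        exact hne (by ext (i | i) <;> rfl)
      simpa using PosDef.pos_of_ne_zero hZp hy
    · have := PosDef.pos_of_ne_zero hYp.inv hx
      have := PosDef.nonneg hZp (x + y)
      linarith
  have hYX₀ : Y₀ * X₀ = 1 := by
    simp only [X₀, Y₀, fromBlocks_multiply, ← fromBlocks_one]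
    have h1 : Y * X = Y * Z + 1 := by rw [hXe, Matrix.mul_add, mul_nonsing_inv _ hYu]
    have h2 : Z⁻¹ * Z = 1 := nonsing_inv_mul _ hZu
    simp [h1, h2, Matrix.add_mul]
  have hY₀ : Y₀.PosDef := by
    rw [← inv_eq_left_inv hYX₀]
    exact hX₀.inv
  let f : s ⊕ c ≃ s ⊕ s := Equiv.sumCongr (Equiv.refl s) e
  refine ⟨X₀.submatrix f f, Y₀.submatrix f f, hX₀.submatrix f.injective,
    hY₀.submatrix f.injective, ?_, ?_, ?_⟩
  · rw [submatrix_mul_equiv, hYX₀, submatrix_one_equiv]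
  · ext i j
    rfl
  · ext i j
    rfl

/-! ### The filtered plant -/

section plantForms

variable {n : Type} [Fintype n] [DecidableEq n] {ℓ : ℕ}

/-- The filtered generalized plant with all its channels. -/
def filteredPlant (ρ μ L : ℝ) (H : LTI n) (lam : Fin (ℓ + 1) → ℝ) :
    Plant (Fin ℓ ⊕ n) (Fin 1) (Fin 1) where
  A := plantA ρ ℓ H
  Bw := plantBw ρ ℓ H
  B := plantB ρ μ L ℓ H
  Cz := plantCz n lam
  Dzw := plantDzw lam
  Dz := plantDz μ L lam
  C := plantC ℓ H

theorem closedLoop_eq_close {m : Type} [Fintype m] (ρ μ L : ℝ) (H : LTI n)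
    (lam : Fin (ℓ + 1) → ℝ) (K : LTI m) :
    closedLoop ρ μ L H lam K = (filteredPlant ρ μ L H lam).close (K.weighted ρ).A (K.weighted ρ).B
      (K.weighted ρ).C (K.weighted ρ).D := rfl

theorem IsKernelBasis.mulVec_eq_zero_iff {m n k : Type} [Fintype n] [Fintype k]
    {M : Matrix m n ℝ} {W : Matrix n k ℝ} (h : IsKernelBasis M W) (x : n → ℝ) :
    M *ᵥ x = 0 ↔ ∃ y, W *ᵥ y = x := by
  have h2 : x ∈ Submodule.span ℝ (Set.range W.col) ↔ M *ᵥ x = 0 := by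
    rw [h.2]; simp
  rw [← h2, ← Matrix.range_mulVecLin]
  simp

theorem IsKernelBasis.mulVec_ne_zero {m n k : Type} [Fintype n] [Fintype k]
    {M : Matrix m n ℝ} {W : Matrix n k ℝ} (h : IsKernelBasis M W) {y : k → ℝ} (hy : y ≠ 0) :
    W *ᵥ y ≠ 0 := by
  intro h0
  exact hy (Matrix.mulVec_injective_iff.2 h.1 (by rw [h0, mulVec_zero]))

theorem hatU_mulVec {k : Type} [Fintype k] (Cperp : Matrix n k ℝ) (a : Fin ℓ → ℝ) (y : k → ℝ)
    (q : Fin 1 → ℝ) :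
    hatU ℓ Cperp *ᵥ Sum.elim (Sum.elim a y) q = Sum.elim (Sum.elim a (Cperp *ᵥ y)) q := by
  simp [hatU, fromBlocks_mulVec_elim]

theorem primal_quad {k : Type} [Fintype k] (ρ : ℝ) (H : LTI n) (Cperp : Matrix n k ℝ)
    (lam : Fin (ℓ + 1) → ℝ) (X : Matrix (Fin ℓ ⊕ n) (Fin ℓ ⊕ n) ℝ) (a : Fin ℓ → ℝ) (y : k → ℝ)
    (q : Fin 1 → ℝ) :
    Sum.elim (Sum.elim a y) q ⬝ᵥ
      ((primalFactor ρ H Cperp lam)ᵀ * middle X (-X) * primalFactor ρ H Cperp lam) *ᵥ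
        Sum.elim (Sum.elim a y) q =
    ((plantA ρ ℓ H) *ᵥ Sum.elim a (Cperp *ᵥ y) + plantBw ρ ℓ H *ᵥ q) ⬝ᵥ
      X *ᵥ (plantA ρ ℓ H *ᵥ Sum.elim a (Cperp *ᵥ y) + plantBw ρ ℓ H *ᵥ q)
      - Sum.elim a (Cperp *ᵥ y) ⬝ᵥ X *ᵥ Sum.elim a (Cperp *ᵥ y)
      + 2 * (q ⬝ᵥ (plantCz n lam *ᵥ Sum.elim a (Cperp *ᵥ y) + plantDzw lam *ᵥ q)) := by
  rw [quad_congr, primalFactor, ← mulVec_mulVec, hatU_mulVec, outer_quad]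

/-- `Û` parametrizes the kernel of `Ĉ` injectively, so the choice of the kernel basis disappears. -/
theorem primal_iff {k : Type} [Fintype k] (ρ μ L : ℝ) {H : LTI n} {Cperp : Matrix n k ℝ}
    (hC : IsKernelBasis H.C Cperp) (lam : Fin (ℓ + 1) → ℝ)
    {X : Matrix (Fin ℓ ⊕ n) (Fin ℓ ⊕ n) ℝ} (hX : X.IsSymm) :
    NegDef ((primalFactor ρ H Cperp lam)ᵀ * middle X (-X) * primalFactor ρ H Cperp lam) ↔
      (filteredPlant ρ μ L H lam).Primal X := by
  rw [negDef_iff, and_iff_right (isSymm_congr (middle_isSymm hX (by simpa [Matrix.IsSymm] using hX)) _),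
    forall_sum_elim]
  have hCz : ∀ a x, (filteredPlant ρ μ L H lam).C *ᵥ Sum.elim a x = H.C *ᵥ x := by
    intro a x
    simp [filteredPlant, plantC]
  constructor
  · intro h
    unfold Plant.Primal
    rw [forall_sum_elim]
    intro a x q hne hx
    rw [hCz] at hx
    obtain ⟨y, rfl⟩ := (IsKernelBasis.mulVec_eq_zero_iff hC x).1 hx
    have h1 := h (Sum.elim a y) q (by
      rw [sum_elim_ne_zero, sum_elim_ne_zero]
      rw [sum_elim_ne_zero] at hne
      refine hne.imp (Or.imp_right ?_) id
      rintro h0 rfl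
      simp at h0)
    rwa [primal_quad ρ] at h1
  · intro h
    rw [forall_sum_elim]
    intro a y q hne
    rw [primal_quad ρ]
    refine h (Sum.elim a (Cperp *ᵥ y)) q ?_ ?_
    · rw [sum_elim_ne_zero, sum_elim_ne_zero] at hne
      rw [sum_elim_ne_zero]
      exact hne.imp (Or.imp_right (IsKernelBasis.mulVec_ne_zero hC)) id
    · rw [hCz, IsKernelBasis.mulVec_eq_zero_iff hC]
      exact ⟨y, rfl⟩

/-- The second component of an annihilator `(v, w)` of `dualRow`, as a function of `v`. -/
def dualWeight (ρ μ L : ℝ) (H : LTI n) (v : n → ℝ) : Fin 1 → ℝ :=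
  (-((L - μ)⁻¹ * (ρ⁻¹ * μ))) • (H.Bᵀ *ᵥ v)

theorem dualRow_mulVec_eq_zero_iff {ρ μ L : ℝ} (hμL : μ < L) (H : LTI n) (v : n → ℝ)
    (w : Fin 1 → ℝ) : dualRow ρ μ L H *ᵥ Sum.elim v w = 0 ↔ w = dualWeight ρ μ L H v := by
  have h : L - μ ≠ 0 := by linarith
  rw [dualRow, fromCols_mulVec_elim, dualWeight]
  constructor
  · intro h0
    ext i
    have := congrFun h0 i
    simp only [smul_mulVec, one_mulVec, Pi.add_apply, Pi.smul_apply, smul_eq_mul,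
      Pi.zero_apply] at this ⊢
    field_simp at this ⊢
    linarith
  · rintro rfl
    ext i
    simp only [smul_mulVec, one_mulVec, Pi.add_apply, Pi.smul_apply, smul_eq_mul, Pi.zero_apply]
    field_simp
    ring

/-- The quadratic form of the dual synthesis inequality on the annihilator of `dualRow`. -/
def dualForm (ρ μ L : ℝ) (H : LTI n) (lam : Fin (ℓ + 1) → ℝ) (N : Matrix n (Fin ℓ) ℝ)
    (Y : Matrix n n ℝ) (v : n → ℝ) (w : Fin 1 → ℝ) : ℝ :=
  v ⬝ᵥ Y *ᵥ v - (ρ ^ 2)⁻¹ * ((H.Aᵀ *ᵥ v) ⬝ᵥ Y *ᵥ (H.Aᵀ *ᵥ v))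
    - 2 * (w ⬝ᵥ ((tildeT ρ μ L H lam N * plantBw ρ ℓ H)ᵀ *ᵥ v + (plantDzw lam)ᵀ *ᵥ w))

theorem dual_quad {k : Type} [Fintype k] (ρ μ L : ℝ) (H : LTI n)
    (Vt : Matrix (n ⊕ Fin 1) k ℝ) (lam : Fin (ℓ + 1) → ℝ) (N : Matrix n (Fin ℓ) ℝ)
    (Y : Matrix n n ℝ) (y : k → ℝ) (v : n → ℝ) (w : Fin 1 → ℝ) (hy : Vt *ᵥ y = Sum.elim v w) :
    y ⬝ᵥ (dualFactor ρ μ L H Vt lam N * middle Y (-((ρ ^ 2)⁻¹ • Y)) *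
      (dualFactor ρ μ L H Vt lam N)ᵀ) *ᵥ y = dualForm ρ μ L H lam N Y v w := by
  have h := quad_congr (dualFactor ρ μ L H Vt lam N)ᵀ (middle Y (-((ρ ^ 2)⁻¹ • Y))) y y
  rw [transpose_transpose] at h
  rw [h]
  have hE : (dualFactor ρ μ L H Vt lam N)ᵀ *ᵥ y =
      Sum.elim (Sum.elim (-v) (H.Aᵀ *ᵥ v)) (Sum.elim (-w)
        ((tildeT ρ μ L H lam N * plantBw ρ ℓ H)ᵀ *ᵥ v + (plantDzw lam)ᵀ *ᵥ w)) := by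
    rw [dualFactor, transpose_mul, transpose_transpose, ← mulVec_mulVec, hy, fromBlocks_transpose,
      fromBlocks_mulVec_elim, transpose_fromCols, transpose_fromCols, transpose_fromCols,
      transpose_fromCols, fromRows_mulVec_elim, fromRows_mulVec_elim, fromRows_mulVec_elim,
      fromRows_mulVec_elim]
    ext ((i | i) | (i | i)) <;> simp [neg_mulVec]
  rw [hE, middle_quad, dualForm]
  simp only [mulVec_neg, dotProduct_neg, neg_dotProduct, neg_mulVec, smul_mulVec, dotProduct_smul,
    smul_eq_mul, neg_neg]
  rw [_root_.dotProduct_comm w]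
  ring

/-- As `L - μ ≠ 0`, the annihilator of `dualRow` is the graph of `dualWeight`; the matrix inequality
becomes one in `v` alone. -/
theorem dual_iff {k : Type} [Fintype k] {ρ μ L : ℝ} (hμL : μ < L) {H : LTI n}
    {Vt : Matrix (n ⊕ Fin 1) k ℝ} (hV : IsKernelBasis (dualRow ρ μ L H) Vt)
    (lam : Fin (ℓ + 1) → ℝ) (N : Matrix n (Fin ℓ) ℝ) {Y : Matrix n n ℝ} (hY : Y.IsSymm) :
    (dualFactor ρ μ L H Vt lam N * middle Y (-((ρ ^ 2)⁻¹ • Y)) *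
      (dualFactor ρ μ L H Vt lam N)ᵀ).PosDef ↔
    ∀ v, v ≠ 0 → 0 < dualForm ρ μ L H lam N Y v (dualWeight ρ μ L H v) := by
  have hs : (dualFactor ρ μ L H Vt lam N * middle Y (-((ρ ^ 2)⁻¹ • Y)) *
      (dualFactor ρ μ L H Vt lam N)ᵀ).IsSymm := by
    have := isSymm_congr (middle_isSymm hY (Y := -((ρ ^ 2)⁻¹ • Y))
      (by simp [Matrix.IsSymm, hY.eq])) (dualFactor ρ μ L H Vt lam N)ᵀ
    rwa [transpose_transpose] at this
  rw [posDef_iff_real, and_iff_right hs]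
  constructor
  · intro h v hv
    obtain ⟨y, hy⟩ := (IsKernelBasis.mulVec_eq_zero_iff hV _).1
      ((dualRow_mulVec_eq_zero_iff hμL H v _).2 rfl)
    rw [← dual_quad ρ μ L H Vt lam N Y y _ _ hy]
    apply h
    rintro rfl
    rw [mulVec_zero] at hy
    exact hv (funext fun i => (congrFun hy (Sum.inl i)).symm)
  · intro h y hy
    obtain ⟨v, w, hvw⟩ : ∃ v w, Vt *ᵥ y = Sum.elim v w :=
      ⟨_, _, (Sum.elim_comp_inl_inr _).symm⟩
    have h0 := (IsKernelBasis.mulVec_eq_zero_iff hV (Vt *ᵥ y)).2 ⟨y, rfl⟩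
    rw [hvw, dualRow_mulVec_eq_zero_iff hμL] at h0
    rw [dual_quad ρ μ L H Vt lam N Y y _ _ hvw, h0]
    apply h
    rintro rfl
    apply IsKernelBasis.mulVec_ne_zero hV hy
    rw [hvw, h0]
    ext (i | i) <;> simp [dualWeight]

theorem coupling_iff {m : Type} [Fintype m] {Y : Matrix n n ℝ} {T : Matrix n m ℝ}
    {X : Matrix m m ℝ} (hY : Y.IsSymm) (hX : X.IsSymm) :
    (fromBlocks Y T Tᵀ X).PosDef ↔ ∀ v x, (v ≠ 0 ∨ x ≠ 0) →
      0 < v ⬝ᵥ Y *ᵥ v + 2 * ((Tᵀ *ᵥ v) ⬝ᵥ x) + x ⬝ᵥ X *ᵥ x := by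
  rw [posDef_iff_real, and_iff_right (by simp [Matrix.IsSymm, fromBlocks_transpose, hX.eq, hY.eq]),
    forall_sum_elim]
  have h : ∀ v x, Sum.elim v x ⬝ᵥ fromBlocks Y T Tᵀ X *ᵥ Sum.elim v x =
      v ⬝ᵥ Y *ᵥ v + 2 * ((Tᵀ *ᵥ v) ⬝ᵥ x) + x ⬝ᵥ X *ᵥ x := by
    intro v x
    rw [fromBlocks_mulVec_elim, sumElim_dotProduct_sumElim, dotProduct_add, dotProduct_add,
      _root_.dotProduct_comm x (Tᵀ *ᵥ v), transpose_dot]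
    ring
  simp only [h, sum_elim_ne_zero]

end plantForms


section sylvester

variable {n : Type} [Fintype n] [DecidableEq n] {ℓ : ℕ}

/-! ### The Sylvester equation -/

/-- The matrix `∑ⱼ λⱼ ρʲ A⁻ʲ`. -/
def filterEval (ρ : ℝ) (A : Matrix n n ℝ) (lam : Fin (ℓ + 1) → ℝ) : Matrix n n ℝ :=
  ∑ j : Fin (ℓ + 1), (lam j * ρ ^ (j : ℕ)) • A⁻¹ ^ (j : ℕ)

theorem tildeT_eq (ρ μ L : ℝ) (H : LTI n) (lam : Fin (ℓ + 1) → ℝ) (N : Matrix n (Fin ℓ) ℝ) :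
    tildeT ρ μ L H lam N = fromCols ((L - μ)⁻¹ • N) (filterEval ρ H.A lam) := rfl

/-- The coefficients `λⱼ` extended by zero. -/
def extendZero (lam : Fin (ℓ + 1) → ℝ) (k : ℕ) : ℝ :=
  if h : k < ℓ + 1 then lam ⟨k, h⟩ else 0

theorem mul_filterA_apply (N : Matrix n (Fin ℓ) ℝ) (i : n) (j : Fin ℓ) :
    (N * filterA ℓ) i j = if h : 0 < (j : ℕ) then N i ⟨j - 1, by omega⟩ else 0 := by
  rw [Matrix.mul_apply]
  split_ifs with h
  · rw [Finset.sum_eq_single (⟨j - 1, by omega⟩ : Fin ℓ)]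
    · have : (j : ℕ) = j - 1 + 1 := by omega
      simp [filterA, ← this]
    · intro k _ hk
      have : ¬ ((j : ℕ) = k + 1) := by
        intro h'
        apply hk
        ext
        simp [h']
      simp [filterA, this]
    · simp
  · refine Finset.sum_eq_zero fun k _ => ?_
    have : ¬ ((j : ℕ) = k + 1) := by omega
    simp [filterA, this]

theorem mul_filterC_apply (B : Matrix n (Fin 1) ℝ) (lam : Fin (ℓ + 1) → ℝ) (i : n) (j : Fin ℓ) :
    (B * filterC lam) i j = B i 0 * extendZero lam (ℓ - j) := by
  have : ℓ - j < ℓ + 1 := by omega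
  simp [Matrix.mul_apply, filterC, extendZero, this]

/-- Right multiplication by `A_f` shifts columns, so the equation is a recursion over the columns of
`N`, with zero as the predecessor of the first. It is solvable once `A_p` is invertible. -/
theorem sylvester_iff (ρ μ : ℝ) (H : LTI n) (lam : Fin (ℓ + 1) → ℝ) (N : Matrix n (Fin ℓ) ℝ) :
    Sylvester ρ μ H lam N ↔ ∀ j : Fin ℓ, H.A *ᵥ N.col j =
      ρ • (if h : 0 < (j : ℕ) then N.col ⟨j - 1, by omega⟩ else 0)
        - (μ * extendZero lam (ℓ - j)) • H.B.col 0 := by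
  unfold Sylvester
  rw [← Matrix.ext_iff, forall_comm]
  refine forall_congr' fun j => ?_
  rw [funext_iff]
  refine forall_congr' fun i => ?_
  have h1 : (H.A * N) i j = (H.A *ᵥ N.col j) i := rfl
  simp only [Matrix.add_apply, Matrix.sub_apply, Matrix.smul_apply, mul_filterA_apply,
    mul_filterC_apply, Matrix.zero_apply, Pi.sub_apply, Pi.smul_apply, smul_eq_mul, h1]
  split_ifs with h
  · simp only [Matrix.col_apply]
    constructor <;> intro h <;> linarith
  · simp only [Matrix.col_apply, Pi.zero_apply]
    constructor <;> intro h <;> linarith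

theorem exists_sylvester (ρ μ : ℝ) {H : LTI n} (hA : IsUnit H.A.det) (lam : Fin (ℓ + 1) → ℝ) :
    ∃ N : Matrix n (Fin ℓ) ℝ, Sylvester ρ μ H lam N := by
  let g : ℕ → n → ℝ := fun j => Nat.rec
    (H.A⁻¹ *ᵥ (-((μ * extendZero lam ℓ) • H.B.col 0)))
    (fun j gj => H.A⁻¹ *ᵥ (ρ • gj - (μ * extendZero lam (ℓ - (j + 1))) • H.B.col 0)) j
  refine ⟨Matrix.of fun i j => g j i, ?_⟩
  rw [sylvester_iff]
  have hcol : ∀ j, (Matrix.of fun i (j : Fin ℓ) => g j i).col j = g j := fun j => rfl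
  intro j
  rw [hcol]
  obtain ⟨j, hj⟩ := j
  cases j with
  | zero => simp [g, mulVec_neg, mulVec_mulVec, mul_nonsing_inv _ hA]
  | succ j =>
    simp only [Nat.succ_pos, dif_pos, hcol, Nat.add_sub_cancel]
    simp only [g, mulVec_mulVec, mul_nonsing_inv _ hA, one_mulVec]

/-- Unrolling the column recursion gives partial sums of the filter series in `A_p⁻¹`, applied to
`B_p`. -/
theorem Sylvester.col_eq {ρ μ : ℝ} {H : LTI n} (hA : IsUnit H.A.det) {lam : Fin (ℓ + 1) → ℝ}
    {N : Matrix n (Fin ℓ) ℝ} (h : Sylvester ρ μ H lam N) (j : ℕ) (hj : j < ℓ) :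
    N.col ⟨j, hj⟩ = (-μ) • ∑ i ∈ Finset.range (j + 1),
      (extendZero lam (ℓ - j + i) * ρ ^ i) • (H.A⁻¹ ^ (i + 1) *ᵥ H.B.col 0) := by
  rw [sylvester_iff] at h
  have hinv : ∀ x y, H.A *ᵥ x = y → x = H.A⁻¹ *ᵥ y := by
    rintro x y rfl
    rw [mulVec_mulVec, nonsing_inv_mul _ hA, one_mulVec]
  induction j with
  | zero =>
    rw [hinv _ _ (h ⟨0, hj⟩)]
    simp [mulVec_neg, mulVec_smul, smul_smul]
  | succ j ih =>
    rw [hinv _ _ (h ⟨j + 1, hj⟩)]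
    simp only [Nat.succ_pos, dif_pos, Nat.add_sub_cancel]
    rw [ih (by omega), Finset.sum_range_succ' _ (j + 1), mulVec_sub, mulVec_smul, mulVec_smul,
      mulVec_smul, mulVec_sum, smul_add]
    have hterm : ∀ i ∈ Finset.range (j + 1),
        (extendZero lam (ℓ - (j + 1) + (i + 1)) * ρ ^ (i + 1)) •
          (H.A⁻¹ ^ (i + 1 + 1) *ᵥ H.B.col 0) =
        ρ • (H.A⁻¹ *ᵥ ((extendZero lam (ℓ - j + i) * ρ ^ i) •
          (H.A⁻¹ ^ (i + 1) *ᵥ H.B.col 0))) := by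
      intro i _
      have : ℓ - (j + 1) + (i + 1) = ℓ - j + i := by omega
      rw [this, mulVec_smul, mulVec_mulVec, ← pow_succ', smul_smul]
      congr 1
      ring
    rw [Finset.sum_congr rfl hterm, ← Finset.smul_sum, smul_comm ρ (-μ)]
    simp [smul_smul, sub_eq_add_neg]

/-- `B_f` picks the last column of `N`, which cancels every term of `∑ λ_j ρ^j A_p^{-j} B_p` except
that of `λ_0`. -/
theorem Sylvester.mul_filterB {ρ μ : ℝ} (hρ : ρ ≠ 0) {H : LTI n} (hA : IsUnit H.A.det)
    {lam : Fin (ℓ + 1) → ℝ} {N : Matrix n (Fin ℓ) ℝ} (h : Sylvester ρ μ H lam N) :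
    N * filterB ℓ + (ρ⁻¹ * μ) • (filterEval ρ H.A lam * H.B) = (lam 0 * (ρ⁻¹ * μ)) • H.B := by
  have hvec : N *ᵥ (filterB ℓ).col 0 + (ρ⁻¹ * μ) • (filterEval ρ H.A lam *ᵥ H.B.col 0) =
      (lam 0 * (ρ⁻¹ * μ)) • H.B.col 0 := by
    have hS : filterEval ρ H.A lam *ᵥ H.B.col 0 = lam 0 • H.B.col 0 +
        ρ • ∑ i ∈ Finset.range ℓ, (extendZero lam (1 + i) * ρ ^ i) •
          (H.A⁻¹ ^ (i + 1) *ᵥ H.B.col 0) := by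
      rw [filterEval, Fin.sum_univ_succ, add_mulVec, sum_mulVec, Finset.smul_sum,
        Finset.sum_range]
      congr 1
      · simp [smul_mulVec]
      · refine Finset.sum_congr rfl fun i _ => ?_
        have : 1 + (i : ℕ) < ℓ + 1 := by omega
        have h2 : (⟨1 + i, this⟩ : Fin (ℓ + 1)) = i.succ := by ext; simp [add_comm]
        rw [extendZero, dif_pos this, h2, smul_mulVec, smul_smul, Fin.val_succ]
        congr 1
        ring
    have hNB : N *ᵥ (filterB ℓ).col 0 = (-μ) • ∑ i ∈ Finset.range ℓ,
        (extendZero lam (1 + i) * ρ ^ i) • (H.A⁻¹ ^ (i + 1) *ᵥ H.B.col 0) := by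
      -- For `ℓ = 0` there is no last column, and both sides are empty sums.
      rcases ℓ with _ | k
      · ext i
        simp [mulVec, dotProduct]
      · have h1 := Sylvester.col_eq hA h k (by omega)
        have h2 : k + 1 - k = 1 := by omega
        rw [h2] at h1
        rw [← h1]
        ext i
        rw [mulVec, dotProduct, Finset.sum_eq_single (⟨k, by omega⟩ : Fin (k + 1))]
        · simp [filterB]
        · intro j _ hj
          have : ¬ ((j : ℕ) = k) := fun h' => hj (Fin.ext h')
          simp [filterB, this]
        · simp
    rw [hS, hNB, smul_add, smul_smul, smul_smul, add_comm (_ • H.B.col 0), ← add_assoc, ← add_smul]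
    have : -μ + ρ⁻¹ * μ * ρ = 0 := by field_simp; ring
    rw [this, zero_smul, zero_add, mul_comm]
  ext i j
  rw [Subsingleton.elim j 0]
  exact congrFun hvec i

theorem commute_filterEval (ρ : ℝ) {A : Matrix n n ℝ} (hA : IsUnit A.det)
    (lam : Fin (ℓ + 1) → ℝ) : filterEval ρ A lam * A = A * filterEval ρ A lam := by
  have h : Commute A⁻¹ A := by
    rw [Commute, SemiconjBy, nonsing_inv_mul _ hA, mul_nonsing_inv _ hA]
  refine (Commute.sum_left _ _ _ fun j _ => ?_ : Commute (filterEval ρ A lam) A)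
  exact (h.pow_left _).smul_left _

/-- Intertwining relation: on the filter block it is the Sylvester equation, on the model block it
says that a polynomial in `A_p⁻¹` commutes with `A_p`. -/
theorem Sylvester.tildeT_mul_plantA {ρ μ L : ℝ} (hρ : ρ ≠ 0) {H : LTI n} (hA : IsUnit H.A.det)
    {lam : Fin (ℓ + 1) → ℝ} {N : Matrix n (Fin ℓ) ℝ} (h : Sylvester ρ μ H lam N) :
    tildeT ρ μ L H lam N * plantA ρ ℓ H = ρ⁻¹ • (H.A * tildeT ρ μ L H lam N)
      + ((L - μ)⁻¹ * (ρ⁻¹ * μ)) • (H.B * plantCz n lam) := by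
  have h1 : N * filterA ℓ = ρ⁻¹ • (H.A * N) + (ρ⁻¹ * μ) • (H.B * filterC lam) := by
    have h2 : ρ • (N * filterA ℓ) = H.A * N + μ • (H.B * filterC lam) := by
      unfold Sylvester at h
      rw [sub_add_eq_add_sub, sub_eq_zero] at h
      exact h.symm
    rw [mul_smul, ← smul_add, ← h2, smul_smul, inv_mul_cancel₀ hρ, one_smul]
  rw [tildeT_eq, plantA, plantCz, fromCols_mul_fromBlocks, mul_fromCols, mul_fromCols]
  ext i (j | j)
  · simp [h1]
    ring
  · simp [commute_filterEval ρ hA lam]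

theorem Sylvester.tildeT_mul_plantB {ρ μ L : ℝ} (hμL : μ < L) (hρ : ρ ≠ 0) {H : LTI n}
    (hA : IsUnit H.A.det) {lam : Fin (ℓ + 1) → ℝ} {N : Matrix n (Fin ℓ) ℝ}
    (h : Sylvester ρ μ H lam N) :
    tildeT ρ μ L H lam N * plantB ρ μ L ℓ H = (lam 0 * (ρ⁻¹ * μ)) • H.B := by
  have : L - μ ≠ 0 := by linarith
  rw [← Sylvester.mul_filterB hρ hA h, tildeT_eq, plantB, fromCols_mul_fromRows]
  simp [smul_smul, mul_inv_cancel₀ this]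

/-- `dualWeight` is exactly the weight that cancels the `B_p Ĉ_z` term, so the adjoint dynamics
leave the range of `T̃ᵀ` invariant. -/
theorem Sylvester.plantA_transpose {ρ μ L : ℝ} (hρ : ρ ≠ 0) {H : LTI n}
    (hA : IsUnit H.A.det) {lam : Fin (ℓ + 1) → ℝ} {N : Matrix n (Fin ℓ) ℝ}
    (h : Sylvester ρ μ H lam N) (v : n → ℝ) :
    (plantA ρ ℓ H)ᵀ *ᵥ ((tildeT ρ μ L H lam N)ᵀ *ᵥ v)
      + (plantCz n lam)ᵀ *ᵥ dualWeight ρ μ L H v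
      = ρ⁻¹ • ((tildeT ρ μ L H lam N)ᵀ *ᵥ (H.Aᵀ *ᵥ v)) := by
  rw [mulVec_mulVec, ← transpose_mul, Sylvester.tildeT_mul_plantA (L := L) hρ hA h, dualWeight,
    transpose_add, transpose_smul, transpose_smul, transpose_mul, transpose_mul, add_mulVec,
    smul_mulVec, smul_mulVec, mulVec_smul, mulVec_mulVec, mulVec_mulVec, neg_smul]
  abel

theorem Sylvester.plantB_transpose {ρ μ L : ℝ} (hμL : μ < L) (hρ : ρ ≠ 0) {H : LTI n}
    (hA : IsUnit H.A.det) {lam : Fin (ℓ + 1) → ℝ} {N : Matrix n (Fin ℓ) ℝ}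
    (h : Sylvester ρ μ H lam N) (v : n → ℝ) :
    (plantB ρ μ L ℓ H)ᵀ *ᵥ ((tildeT ρ μ L H lam N)ᵀ *ᵥ v)
      + (plantDz μ L lam)ᵀ *ᵥ dualWeight ρ μ L H v = 0 := by
  have : L - μ ≠ 0 := by linarith
  rw [mulVec_mulVec, ← transpose_mul, Sylvester.tildeT_mul_plantB hμL hρ hA h, dualWeight]
  ext i
  rw [Subsingleton.elim i 0]
  simp [plantDz, filterD, smul_mulVec, mulVec, dotProduct]
  field_simp
  ring

/-! ### Consequences of the Zames–Falb constraints -/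

theorem zfParams.sum_le {ρ : ℝ} {lam : Fin (ℓ + 1) → ℝ} (h : lam ∈ zfParams ρ ℓ) :
    ∑ j : Fin ℓ, -lam j.succ * (ρ ^ ((j : ℕ) + 1))⁻¹ ≤ lam 0 := by
  have h2 := h.2
  rw [Fin.sum_univ_succ] at h2
  simp only [Fin.val_zero, pow_zero, inv_one, one_mul, Fin.val_succ] at h2
  have : ∑ j : Fin ℓ, -lam j.succ * (ρ ^ ((j : ℕ) + 1))⁻¹ =
      -∑ j : Fin ℓ, (ρ ^ ((j : ℕ) + 1))⁻¹ * lam j.succ := by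
    rw [← Finset.sum_neg_distrib]
    exact Finset.sum_congr rfl fun j _ => by ring
  rw [this]
  linarith

/-- The `λ_0` term dominates: in a norm invariant under `A`, the other terms have total size at most
`∑ -λ_j ρ^j ≤ ρ λ_0 < λ_0`, so the kernel is trivial. -/
theorem isUnit_filterEval {ρ : ℝ} (hρ0 : 0 < ρ) (hρ1 : ρ < 1) {A : Matrix n n ℝ} {m : ℕ}
    (hm : 0 < m) (hA : A ^ m = 1) {lam : Fin (ℓ + 1) → ℝ} (hlam : lam ∈ zfParams ρ ℓ)
    (h0 : 0 < lam 0) : IsUnit (filterEval ρ A lam) := by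
  have hAu : IsUnit A := IsUnit.of_pow_eq_one hA hm.ne'
  have hAd : IsUnit A.det := (isUnit_iff_isUnit_det _).1 hAu
  rw [← mulVec_injective_iff_isUnit]
  rw [← coe_mulVecLin, ← LinearMap.ker_eq_bot, LinearMap.ker_eq_bot']
  intro x hx
  rw [mulVecLin_apply] at hx
  -- Summing over one period of `A` gives an `A`-invariant norm.
  let h : (n → ℝ) → ℝ := fun x => ∑ k ∈ Finset.range m, ‖A ^ k *ᵥ x‖
  have hA1 : ∀ x, h (A *ᵥ x) = h x := by
    intro x
    have h1 := Finset.sum_range_succ (fun k => ‖A ^ k *ᵥ x‖) m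
    rw [Finset.sum_range_succ', hA] at h1
    simp only [h, mulVec_mulVec, ← pow_succ]
    simpa using h1
  have hAi : ∀ (j : ℕ) x, h (A⁻¹ ^ j *ᵥ x) = h x := by
    intro j
    induction j with
    | zero => simp
    | succ j ih =>
      intro x
      rw [← hA1, mulVec_mulVec, pow_succ', ← Matrix.mul_assoc, mul_nonsing_inv _ hAd,
        Matrix.one_mul, ih]
  have hadd : ∀ x y, h (x + y) ≤ h x + h y := by
    intro x y
    simp only [h, ← Finset.sum_add_distrib, mulVec_add]
    exact Finset.sum_le_sum fun k _ => norm_add_le _ _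
  have hsmul : ∀ (c : ℝ) x, h (c • x) = |c| * h x := by
    intro c x
    simp only [h, mulVec_smul, norm_smul, Finset.mul_sum, Real.norm_eq_abs]
  have hzero : h 0 = 0 := by simp [h]
  have hsum : ∀ (s : Finset (Fin ℓ)) (f : Fin ℓ → n → ℝ), h (∑ j ∈ s, f j) ≤ ∑ j ∈ s, h (f j) := by
    intro s f
    exact Finset.le_sum_of_subadditive h hzero.le hadd s f
  have hnn : ∀ x, 0 ≤ h x := fun x => Finset.sum_nonneg fun k _ => norm_nonneg _
  rw [filterEval, Fin.sum_univ_succ, add_mulVec, sum_mulVec] at hx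
  simp only [Fin.val_zero, pow_zero, mul_one, smul_mulVec, one_mulVec] at hx
  have hx2 : lam 0 • x = ∑ j : Fin ℓ, (-lam j.succ * ρ ^ ((j : ℕ) + 1)) •
      (A⁻¹ ^ ((j : ℕ) + 1) *ᵥ x) := by
    rw [eq_neg_of_add_eq_zero_left hx, ← Finset.sum_neg_distrib]
    refine Finset.sum_congr rfl fun j _ => ?_
    rw [Fin.val_succ, ← neg_smul, neg_mul]
  have hle : lam 0 * h x ≤ ∑ j : Fin ℓ, (-lam j.succ * ρ ^ ((j : ℕ) + 1)) * h x := by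
    have h1 : h (lam 0 • x) = lam 0 * h x := by rw [hsmul, abs_of_pos h0]
    rw [← h1, hx2]
    refine (hsum _ _).trans (Finset.sum_le_sum fun j _ => ?_)
    rw [hsmul, hAi, abs_of_nonneg]
    exact mul_nonneg (by linarith [hlam.1 j]) (by positivity)
  have hle2 : ∑ j : Fin ℓ, (-lam j.succ * ρ ^ ((j : ℕ) + 1)) ≤ ρ * lam 0 := by
    refine le_trans ?_ (mul_le_mul_of_nonneg_left (zfParams.sum_le hlam) hρ0.le)
    rw [Finset.mul_sum]
    refine Finset.sum_le_sum fun j _ => ?_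
    have h1 : ρ ^ ((j : ℕ) + 1) ≤ ρ := by
      simpa using pow_le_pow_of_le_one hρ0.le hρ1.le (show 1 ≤ (j : ℕ) + 1 by omega)
    have h2 : 1 ≤ (ρ ^ ((j : ℕ) + 1))⁻¹ := (one_le_inv₀ (by positivity)).2 (h1.trans hρ1.le)
    have h3 : ρ ^ ((j : ℕ) + 1) ≤ ρ * (ρ ^ ((j : ℕ) + 1))⁻¹ := by nlinarith
    nlinarith [hlam.1 j]
  rw [← Finset.sum_mul] at hle
  have hx0 : h x = 0 := by
    by_contra hne
    have hpos : 0 < h x := lt_of_le_of_ne (hnn x) (Ne.symm hne)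
    have : lam 0 ≤ ρ * lam 0 := (le_of_mul_le_mul_right hle hpos).trans hle2
    nlinarith
  have := (Finset.sum_eq_zero_iff_of_nonneg (fun k _ => norm_nonneg _)).1 hx0 0
    (Finset.mem_range.2 hm)
  simpa using this

/-- The zero dynamics of the filter. -/
def filterZero (lam : Fin (ℓ + 1) → ℝ) : Matrix (Fin ℓ) (Fin ℓ) ℝ :=
  filterA ℓ - (lam 0)⁻¹ • (filterB ℓ * filterC lam)

theorem filterZero_apply (lam : Fin (ℓ + 1) → ℝ) (i j : Fin ℓ) :
    filterZero lam i j = (if (j : ℕ) = i + 1 then 1 else 0)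
      + if (i : ℕ) + 1 = ℓ then (lam 0)⁻¹ * -lam (Fin.rev j).succ else 0 := by
  have h : (⟨ℓ - j, by omega⟩ : Fin (ℓ + 1)) = (Fin.rev j).succ := by
    ext
    simp [Fin.val_rev]
    omega
  simp only [filterZero, filterA, filterB, filterC, Matrix.sub_apply, Matrix.smul_apply,
    Matrix.mul_apply, Matrix.of_apply, h, smul_eq_mul]
  split_ifs <;> simp [sub_eq_add_neg]

/-- The weights `ρ^j` form a Perron-type supersolution: every row but the last shifts them exactly,
and the last row is the Zames–Falb sum constraint divided by `λ_0`. -/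
theorem filterZero_mulVec_le {ρ : ℝ} (hρ0 : 0 < ρ) {lam : Fin (ℓ + 1) → ℝ}
    (hlam : lam ∈ zfParams ρ ℓ) (h0 : 0 < lam 0) (i : Fin ℓ) :
    (filterZero lam *ᵥ fun j : Fin ℓ => ρ ^ (j : ℕ)) i ≤ ρ * ρ ^ (i : ℕ) := by
  simp only [mulVec, dotProduct, filterZero_apply, add_mul, Finset.sum_add_distrib]
  by_cases hi : (i : ℕ) + 1 = ℓ
  · have h1 : ∑ j : Fin ℓ, (if (j : ℕ) = i + 1 then (1 : ℝ) else 0) * ρ ^ (j : ℕ) = 0 := by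
      refine Finset.sum_eq_zero fun j _ => ?_
      rw [if_neg (by omega), zero_mul]
    rw [h1, zero_add]
    simp only [hi, if_true]
    rw [← pow_succ', hi, ← Equiv.sum_comp Fin.revPerm]
    have h2 : ∀ j : Fin ℓ, (lam 0)⁻¹ * -lam (Fin.rev (Fin.revPerm j)).succ *
        ρ ^ ((Fin.revPerm j : Fin ℓ) : ℕ) =
        (lam 0)⁻¹ * ρ ^ ℓ * (-lam j.succ * (ρ ^ ((j : ℕ) + 1))⁻¹) := by
      intro j
      have h3 : ρ ^ ℓ = ρ ^ (ℓ - (j + 1)) * ρ ^ ((j : ℕ) + 1) := by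
        rw [← pow_add]; congr 1; omega
      rw [h3, Fin.revPerm_apply, Fin.rev_rev, Fin.val_rev]
      field_simp
    rw [Finset.sum_congr rfl fun j _ => h2 j, ← Finset.mul_sum]
    calc (lam 0)⁻¹ * ρ ^ ℓ * ∑ j : Fin ℓ, -lam j.succ * (ρ ^ ((j : ℕ) + 1))⁻¹
        ≤ (lam 0)⁻¹ * ρ ^ ℓ * lam 0 :=
          mul_le_mul_of_nonneg_left (zfParams.sum_le hlam) (by positivity)
      _ = ρ ^ ℓ := by field_simp
  · simp only [hi, if_false, zero_mul, Finset.sum_const_zero, add_zero]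
    rw [Finset.sum_eq_single (⟨i + 1, by omega⟩ : Fin ℓ)]
    · simp [pow_succ']
    · intro j _ hj
      have : ¬ ((j : ℕ) = i + 1) := fun h' => hj (Fin.ext h')
      simp [this]
    · simp

/-- The sign constraints make the matrix entrywise nonnegative, so the supersolution bound can be
iterated, and each entry is at most its whole weighted row sum. -/
theorem filterZero_pow_bounds {ρ : ℝ} (hρ0 : 0 < ρ) {lam : Fin (ℓ + 1) → ℝ}
    (hlam : lam ∈ zfParams ρ ℓ) (h0 : 0 < lam 0) (k : ℕ) (i j : Fin ℓ) :
    0 ≤ (filterZero lam ^ k) i j ∧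
      (filterZero lam ^ k) i j ≤ ρ ^ k * (ρ ^ (i : ℕ) * (ρ ^ (j : ℕ))⁻¹) := by
  have hnn : ∀ i j, 0 ≤ filterZero lam i j := by
    intro i j
    rw [filterZero_apply]
    have := hlam.1 (Fin.rev j)
    have h1 : 0 ≤ (lam 0)⁻¹ * -lam (Fin.rev j).succ :=
      mul_nonneg (inv_nonneg.2 h0.le) (by linarith)
    split_ifs <;> linarith
  have hpow : ∀ k i j, 0 ≤ (filterZero lam ^ k) i j := by
    intro k
    induction k with
    | zero => intro i j; rw [pow_zero, Matrix.one_apply]; split_ifs <;> norm_num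
    | succ k ih =>
      intro i j
      rw [pow_succ, Matrix.mul_apply]
      exact Finset.sum_nonneg fun l _ => mul_nonneg (ih i l) (hnn l j)
  refine ⟨hpow k i j, ?_⟩
  have hmono : ∀ (u v : Fin ℓ → ℝ) i, (∀ j, u j ≤ v j) →
      (filterZero lam *ᵥ u) i ≤ (filterZero lam *ᵥ v) i := fun u v i huv => by
    simp only [mulVec, dotProduct]
    exact Finset.sum_le_sum fun j _ => mul_le_mul_of_nonneg_left (huv j) (hnn i j)
  have hw : ∀ (k : ℕ) (i : Fin ℓ), (filterZero lam ^ k *ᵥ fun j : Fin ℓ => ρ ^ (j : ℕ)) i ≤ ρ ^ k * ρ ^ (i : ℕ) := by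
    intro k
    induction k with
    | zero => simp
    | succ k ih =>
      intro i
      rw [pow_succ' (filterZero lam), ← mulVec_mulVec]
      calc (filterZero lam *ᵥ (filterZero lam ^ k *ᵥ fun j : Fin ℓ => ρ ^ (j : ℕ))) i
          ≤ (filterZero lam *ᵥ fun j : Fin ℓ => ρ ^ k * ρ ^ (j : ℕ)) i :=
            hmono _ _ i ih
        _ = ρ ^ k * (filterZero lam *ᵥ fun j : Fin ℓ => ρ ^ (j : ℕ)) i := by
            have : (fun j : Fin ℓ => ρ ^ k * ρ ^ (j : ℕ)) = ρ ^ k • fun j : Fin ℓ => ρ ^ (j : ℕ) :=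
              rfl
            rw [this, mulVec_smul]
            rfl
        _ ≤ ρ ^ k * (ρ * ρ ^ (i : ℕ)) :=
            mul_le_mul_of_nonneg_left (filterZero_mulVec_le hρ0 hlam h0 i) (by positivity)
        _ = ρ ^ (k + 1) * ρ ^ (i : ℕ) := by ring
  have h1 : (filterZero lam ^ k) i j * ρ ^ (j : ℕ) ≤ ρ ^ k * ρ ^ (i : ℕ) := by
    refine le_trans ?_ (hw k i)
    exact Finset.single_le_sum (f := fun j => (filterZero lam ^ k) i j * ρ ^ (j : ℕ))
      (fun l _ => mul_nonneg (hpow k i l) (by positivity)) (Finset.mem_univ j)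
  rw [← mul_assoc, ← div_eq_mul_inv, le_div_iff₀ (by positivity)]
  exact h1

/-- Lyapunov's theorem for a matrix with a power of Frobenius norm less than one. -/
theorem exists_lyapunov {M : Matrix n n ℝ} {m : ℕ} (hM : ∑ i, ∑ j, (M ^ m) i j ^ 2 < 1) :
    ∃ P : Matrix n n ℝ, P.IsSymm ∧ (∀ b, 0 ≤ b ⬝ᵥ P *ᵥ b) ∧
      ∀ b, b ≠ 0 → (M *ᵥ b) ⬝ᵥ P *ᵥ (M *ᵥ b) < b ⬝ᵥ P *ᵥ b := by
  have hP : ∀ b, b ⬝ᵥ (∑ k ∈ Finset.range m, (M ^ k)ᵀ * M ^ k) *ᵥ b =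
      ∑ k ∈ Finset.range m, (M ^ k *ᵥ b) ⬝ᵥ (M ^ k *ᵥ b) := by
    intro b
    rw [sum_mulVec, dotProduct_sum]
    refine Finset.sum_congr rfl fun k _ => ?_
    rw [← mulVec_mulVec, _root_.dotProduct_comm, transpose_dot]
  -- The increment of this form along `M` telescopes to `|M^m b|² - |b|²`, negative by
  -- Cauchy–Schwarz.
  refine ⟨∑ k ∈ Finset.range m, (M ^ k)ᵀ * M ^ k, ?_, ?_, ?_⟩
  · simp [Matrix.IsSymm, transpose_sum, transpose_mul]
  · intro b
    rw [hP]
    exact Finset.sum_nonneg fun k _ => by simpa using dotProduct_star_self_nonneg (M ^ k *ᵥ b)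
  · intro b hb
    have hbb : 0 < b ⬝ᵥ b := by
      have := PosDef.pos_of_ne_zero (Matrix.PosDef.one (n := n) (R := ℝ)) hb
      simpa using this
    have hlt : (M ^ m *ᵥ b) ⬝ᵥ (M ^ m *ᵥ b) < b ⬝ᵥ b := by
      calc (M ^ m *ᵥ b) ⬝ᵥ (M ^ m *ᵥ b) = ∑ i, (∑ j, (M ^ m) i j * b j) ^ 2 := by
            simp only [dotProduct, mulVec, sq]
        _ ≤ ∑ i, (∑ j, (M ^ m) i j ^ 2) * ∑ j, b j ^ 2 :=
            Finset.sum_le_sum fun i _ => Finset.sum_mul_sq_le_sq_mul_sq _ _ _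
        _ = (∑ i, ∑ j, (M ^ m) i j ^ 2) * (b ⬝ᵥ b) := by
            rw [← Finset.sum_mul]; simp only [dotProduct, sq]
        _ < b ⬝ᵥ b := by nlinarith
    rw [hP, hP]
    have h1 := Finset.sum_range_succ (fun k => (M ^ k *ᵥ b) ⬝ᵥ (M ^ k *ᵥ b)) m
    rw [Finset.sum_range_succ'] at h1
    simp only [mulVec_mulVec, ← pow_succ]
    simp only [pow_zero, one_mulVec] at h1
    linarith

theorem exists_filterZero_lyapunov {ρ : ℝ} (hρ0 : 0 < ρ) (hρ1 : ρ < 1) {lam : Fin (ℓ + 1) → ℝ}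
    (hlam : lam ∈ zfParams ρ ℓ) (h0 : 0 < lam 0) :
    ∃ P : Matrix (Fin ℓ) (Fin ℓ) ℝ, P.IsSymm ∧ (∀ b, 0 ≤ b ⬝ᵥ P *ᵥ b) ∧
      ∀ b, b ≠ 0 → ((filterZero lam)ᵀ *ᵥ b) ⬝ᵥ P *ᵥ ((filterZero lam)ᵀ *ᵥ b) < b ⬝ᵥ P *ᵥ b := by
  have hent : ∀ i j, Filter.Tendsto (fun k : ℕ => ((filterZero lam)ᵀ ^ k) i j) Filter.atTop
      (nhds 0) := by
    intro i j
    simp only [← transpose_pow, transpose_apply]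
    refine squeeze_zero (fun k => (filterZero_pow_bounds hρ0 hlam h0 k j i).1)
      (fun k => (filterZero_pow_bounds hρ0 hlam h0 k j i).2) ?_
    simpa using (tendsto_pow_atTop_nhds_zero_of_lt_one hρ0.le hρ1).mul_const _
  have hsum : Filter.Tendsto (fun k : ℕ => ∑ i, ∑ j, ((filterZero lam)ᵀ ^ k) i j ^ 2) Filter.atTop
      (nhds (∑ _i : Fin ℓ, ∑ _j : Fin ℓ, (0 : ℝ) ^ 2)) :=
    tendsto_finsetSum _ fun i _ => tendsto_finsetSum _ fun j _ => (hent i j).pow 2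
  have h1 : (∑ _i : Fin ℓ, ∑ _j : Fin ℓ, (0 : ℝ) ^ 2) < 1 := by simp
  obtain ⟨m, hm⟩ := (hsum.eventually_lt_const h1).exists
  exact exists_lyapunov hm

end sylvester


/-! ### Necessity and sufficiency of the synthesis conditions -/

section synthesisConditions

variable {n : Type} [Fintype n] [DecidableEq n] {ℓ : ℕ}

theorem toBlocks₁₁_isSymm {s c : Type*} {X : Matrix (s ⊕ c) (s ⊕ c) ℝ} (hX : X.IsSymm) :
    X.toBlocks₁₁.IsSymm := by
  ext i j
  exact congrFun (congrFun hX (Sum.inl i)) (Sum.inl j)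

/-- Testing with zero state and `q = 1` leaves a nonnegative storage term minus `2 λ_0`. -/
theorem lam_zero_pos_of_primal {ρ μ L : ℝ} {H : LTI n} {lam : Fin (ℓ + 1) → ℝ}
    {X : Matrix (Fin ℓ ⊕ n) (Fin ℓ ⊕ n) ℝ} (hX : ∀ x, 0 ≤ x ⬝ᵥ X *ᵥ x)
    (h : (filteredPlant ρ μ L H lam).Primal X) : 0 < lam 0 := by
  have h1 := h 0 1 (Or.inr one_ne_zero) (by simp)
  have h2 := hX ((filteredPlant ρ μ L H lam).Bw *ᵥ 1)
  simp only [mulVec_zero, zero_add, zero_dotProduct, sub_zero] at h1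
  have h3 : (1 : Fin 1 → ℝ) ⬝ᵥ (filteredPlant ρ μ L H lam).Dzw *ᵥ 1 = -lam 0 := by
    simp [filteredPlant, plantDzw, filterD, dotProduct, mulVec]
  rw [h3] at h1
  linarith

theorem dualWeight_smul (ρ μ L : ℝ) (H : LTI n) (r : ℝ) (v : n → ℝ) :
    dualWeight ρ μ L H (r • v) = r • dualWeight ρ μ L H v := by
  rw [dualWeight, dualWeight, mulVec_smul, smul_comm]

theorem plantDzw_transpose (lam : Fin (ℓ + 1) → ℝ) : (plantDzw lam)ᵀ = plantDzw lam := by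
  ext i j
  rw [Subsingleton.elim i j]
  rfl

/-- The synthesis conditions are necessary. -/
theorem exists_synthesis_of_analysis {ρ μ L : ℝ} (hμL : μ < L) (hρ0 : 0 < ρ) (hρ1 : ρ < 1)
    {H : LTI n} {m : ℕ} (hm : 0 < m) (hA : H.A ^ m = 1) {k₁ k₂ : Type} [Fintype k₁] [Fintype k₂]
    {Cperp : Matrix n k₁ ℝ} (hC : IsKernelBasis H.C Cperp)
    {Vt : Matrix (n ⊕ Fin 1) k₂ ℝ} (hV : IsKernelBasis (dualRow ρ μ L H) Vt)
    {c : Type} [Fintype c] [DecidableEq c] {K : LTI c} {lam : Fin (ℓ + 1) → ℝ}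
    (hlam : lam ∈ zfParams ρ ℓ) {X : Matrix ((Fin ℓ ⊕ n) ⊕ c) ((Fin ℓ ⊕ n) ⊕ c) ℝ}
    (h : AnalysisLMI (closedLoop ρ μ L H lam K) X) :
    ∃ (N : Matrix n (Fin ℓ) ℝ) (Xhat : Matrix (Fin ℓ ⊕ n) (Fin ℓ ⊕ n) ℝ) (Y : Matrix n n ℝ),
      Xhat.IsSymm ∧ Y.IsSymm ∧ Sylvester ρ μ H lam N ∧
        SynthesisLMI ρ μ L H Cperp Vt N Xhat Y lam := by
  have hAd : IsUnit H.A.det :=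
    (isUnit_iff_isUnit_det _).1 (IsUnit.of_pow_eq_one hA hm.ne')
  obtain ⟨N, hN⟩ := exists_sylvester ρ μ hAd lam
  rw [closedLoop_eq_close] at h
  have hX := h.1
  have hXs := PosDef.isSymm_real hX
  have hXi := hX.inv
  have hXis := PosDef.isSymm_real hXi
  have hYX : X⁻¹ * X = 1 := nonsing_inv_mul _ ((isUnit_iff_isUnit_det _).1 hX.isUnit)
  have hprimal := Plant.primal_of_analysisLMI _ h
  have hdual := Plant.dual_of_analysisLMI _ h
  have hX11 : ∀ x, x ≠ 0 → 0 < x ⬝ᵥ X.toBlocks₁₁ *ᵥ x := by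
    intro x hx
    rw [← toBlocks₁₁_quad]
    exact PosDef.pos_of_ne_zero hX (sum_elim_ne_zero.2 (Or.inl hx))
  have hX11s := toBlocks₁₁_isSymm hXs
  have hl0 : 0 < lam 0 := lam_zero_pos_of_primal
    (fun x => by rw [← toBlocks₁₁_quad]; exact PosDef.nonneg hX _) hprimal
  have hS := isUnit_filterEval hρ0 hρ1 hm hA hlam hl0
  set T := tildeT ρ μ L H lam N with hT
  -- The second block of `T̃ᵀ` is the invertible filter sum.
  have hTinj : ∀ v, Tᵀ *ᵥ v = 0 → v = 0 := by
    intro v hv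
    rw [hT, tildeT_eq, transpose_fromCols, fromRows_mulVec_elim] at hv
    have h2 : (filterEval ρ H.A lam)ᵀ *ᵥ v = 0 := funext fun i => congrFun hv (Sum.inr i)
    exact (mulVec_injective_iff_isUnit.2 ((isUnit_transpose _).2 hS)) (by rw [h2, mulVec_zero])
  set Yhat := X⁻¹.toBlocks₁₁ with hYhat
  have hYs : Yhat.IsSymm := toBlocks₁₁_isSymm hXis
  have hTY : ∀ v w, v ⬝ᵥ (T * Yhat * Tᵀ) *ᵥ w = (Tᵀ *ᵥ v) ⬝ᵥ Yhat *ᵥ (Tᵀ *ᵥ w) := by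
    intro v w
    simpa using quad_congr Tᵀ Yhat v w
  have hTYs : (T * Yhat * Tᵀ).IsSymm := by
    simpa using isSymm_congr hYs Tᵀ
  have hg : ∀ v, v ≠ 0 →
      0 < dualForm ρ μ L H lam N (T * Yhat * Tᵀ) v (dualWeight ρ μ L H v) := by
    intro v hv
    have h1 := hdual (Tᵀ *ᵥ v) (dualWeight ρ μ L H v)
      (Or.inl fun h0 => hv (hTinj v h0)) (Sylvester.plantB_transpose hμL hρ0.ne' hAd hN v)
    have h2 := Sylvester.plantA_transpose (L := L) hρ0.ne' hAd hN v
    simp only [filteredPlant] at h1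
    rw [← hT] at h2
    rw [h2] at h1
    rw [dualForm, hTY, hTY, ← hT, plantDzw_transpose, transpose_mul, ← mulVec_mulVec]
    simp only [mulVec_smul, dotProduct_smul, smul_dotProduct, smul_eq_mul] at h1
    have h3 : (ρ ^ 2)⁻¹ = ρ⁻¹ * ρ⁻¹ := by rw [sq, mul_inv]
    rw [h3]
    linarith
  -- The dual inequality for `T Ŷ Tᵀ` is strict, so it survives adding `t⁻¹ I` for large `t`; `f` is
  -- the contribution of `I`.
  obtain ⟨t₀, ht₀⟩ := exists_forall_pos_add_mul (E := n → ℝ)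
    (f := fun v => v ⬝ᵥ v - (ρ ^ 2)⁻¹ * ((H.Aᵀ *ᵥ v) ⬝ᵥ (H.Aᵀ *ᵥ v)))
    (g := fun v => dualForm ρ μ L H lam N (T * Yhat * Tᵀ) v (dualWeight ρ μ L H v))
    (by fun_prop) (by unfold dualForm dualWeight; fun_prop)
    (fun r v => by simp [mulVec_smul]; ring)
    (fun r v => by
      simp only [dualForm, dualWeight_smul, mulVec_smul, ← smul_add, dotProduct_smul,
        smul_dotProduct, smul_eq_mul]
      ring)
    (fun v => by
      by_cases hv : v = 0
      · simp [hv, dualForm, dualWeight]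
      · exact (hg v hv).le)
    (fun v hv h0 => absurd h0 (hg v hv).ne')
  set t := max t₀ 1 with ht
  have htpos : 0 < t := lt_max_of_lt_right one_pos
  have hYts : (T * Yhat * Tᵀ + t⁻¹ • (1 : Matrix n n ℝ)).IsSymm :=
    hTYs.add (Matrix.IsSymm.smul Matrix.isSymm_one t⁻¹)
  refine ⟨N, X.toBlocks₁₁, T * Yhat * Tᵀ + t⁻¹ • (1 : Matrix n n ℝ), hX11s, hYts, hN, ?_, ?_, ?_⟩
  · exact (primal_iff ρ μ L hC lam hX11s).2 hprimal
  · rw [dual_iff hμL hV lam N hYts]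
    intro v hv
    have h1 := ht₀ t (le_max_left _ _) v hv
    have h2 : dualForm ρ μ L H lam N (T * Yhat * Tᵀ + t⁻¹ • (1 : Matrix n n ℝ)) v
        (dualWeight ρ μ L H v) = t⁻¹ * ((v ⬝ᵥ v - (ρ ^ 2)⁻¹ * ((H.Aᵀ *ᵥ v) ⬝ᵥ (H.Aᵀ *ᵥ v)))
          + t * dualForm ρ μ L H lam N (T * Yhat * Tᵀ) v (dualWeight ρ μ L H v)) := by
      rw [mul_add, inv_mul_cancel_left₀ htpos.ne']
      simp only [dualForm, add_mulVec, smul_mulVec, one_mulVec, dotProduct_add, dotProduct_smul,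
        smul_eq_mul]
      ring
    rw [h2]
    exact mul_pos (inv_pos.2 htpos) h1
  · rw [← hT, coupling_iff hYts hX11s]
    intro v x hne
    -- For the block of an inverse, coupling is in general only semidefinite; the added `t⁻¹ |v|²`
    -- makes it strict.
    have hsq := two_mul_dot_le hXi hYX (Sum.elim (-(Tᵀ *ᵥ v)) 0) (Sum.elim x 0)
    rw [toBlocks₁₁_quad, toBlocks₁₁_quad, sumElim_dotProduct_sumElim, zero_dotProduct, ← hYhat] at hsq
    simp only [mulVec_neg, dotProduct_neg, neg_dotProduct, neg_neg, ← hTY] at hsq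
    simp only [add_mulVec, smul_mulVec, one_mulVec, dotProduct_add, dotProduct_smul, smul_eq_mul]
    by_cases hv : v = 0
    · subst hv
      have := hX11 x (by simpa using hne)
      simpa using this
    · have hvv : 0 < v ⬝ᵥ v := by
        simpa using PosDef.pos_of_ne_zero (Matrix.PosDef.one (n := n) (R := ℝ)) hv
      have := mul_pos (inv_pos.2 htpos) hvv
      linarith

/-- The synthesis conditions are sufficient. -/
theorem exists_controller_of_synthesis {ρ μ L : ℝ} (hμL : μ < L) (hρ0 : 0 < ρ) (hρ1 : ρ < 1)
    {H : LTI n} {m : ℕ} (hm : 0 < m) (hA : H.A ^ m = 1) {k₁ k₂ : Type} [Fintype k₁] [Fintype k₂]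
    {Cperp : Matrix n k₁ ℝ} (hC : IsKernelBasis H.C Cperp)
    {Vt : Matrix (n ⊕ Fin 1) k₂ ℝ} (hV : IsKernelBasis (dualRow ρ μ L H) Vt)
    {c : Type} [Fintype c] [DecidableEq c] (e : c ≃ Fin ℓ ⊕ n) {lam : Fin (ℓ + 1) → ℝ}
    (hlam : lam ∈ zfParams ρ ℓ) {N : Matrix n (Fin ℓ) ℝ}
    {Xhat : Matrix (Fin ℓ ⊕ n) (Fin ℓ ⊕ n) ℝ} {Y : Matrix n n ℝ} (hXs : Xhat.IsSymm)
    (hYs : Y.IsSymm) (hN : Sylvester ρ μ H lam N)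
    (h : SynthesisLMI ρ μ L H Cperp Vt N Xhat Y lam) :
    ∃ (K : LTI c) (X : Matrix ((Fin ℓ ⊕ n) ⊕ c) ((Fin ℓ ⊕ n) ⊕ c) ℝ),
      AnalysisLMI (closedLoop ρ μ L H lam K) X := by
  have hAd : IsUnit H.A.det :=
    (isUnit_iff_isUnit_det _).1 (IsUnit.of_pow_eq_one hA hm.ne')
  have hLμ : L - μ ≠ 0 := by linarith
  have hprimal := (primal_iff ρ μ L hC lam hXs).1 h.primal
  have hdual := (dual_iff hμL hV lam N hYs).1 h.dual
  have hcoup := (coupling_iff hYs hXs).1 h.coupling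
  have hXnn : ∀ x, 0 ≤ x ⬝ᵥ Xhat *ᵥ x := by
    intro x
    by_cases hx : x = 0
    · simp [hx]
    · simpa using (hcoup 0 x (Or.inr hx)).le
  have hl0 : 0 < lam 0 := lam_zero_pos_of_primal hXnn hprimal
  have hS := isUnit_filterEval hρ0 hρ1 hm hA hlam hl0
  obtain ⟨P, hPs, hPnn, hP⟩ := exists_filterZero_lyapunov hρ0 hρ1 hlam hl0
  set T := tildeT ρ μ L H lam N with hT
  set M := (filterZero lam)ᵀ with hM
  -- `R (b, v) = Tᵀ v + (b, 0)`: coordinates adapted to the range of `Tᵀ` and the pure filter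
  -- directions. `R` is triangular with the invertible filter sum on its diagonal.
  set R : Matrix (Fin ℓ ⊕ n) (Fin ℓ ⊕ n) ℝ :=
    fromBlocks 1 ((L - μ)⁻¹ • Nᵀ) 0 (filterEval ρ H.A lam)ᵀ with hR
  have hRe : ∀ (b : Fin ℓ → ℝ) v, R *ᵥ Sum.elim b v = Tᵀ *ᵥ v + Sum.elim b 0 := by
    intro b v
    rw [hR, hT, tildeT_eq, transpose_fromCols, fromRows_mulVec_elim, fromBlocks_mulVec_elim]
    ext (i | i)
    · simp [add_comm]
    · simp
  have hRd : IsUnit R.det := by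
    rw [hR, det_fromBlocks_zero₂₁, det_one, one_mul, det_transpose]
    exact (isUnit_iff_isUnit_det _).1 hS
  let Yt : ℝ → Matrix (Fin ℓ ⊕ n) (Fin ℓ ⊕ n) ℝ := fun t =>
    R⁻¹ᵀ * fromBlocks (t • P) 0 0 Y * R⁻¹
  have hYts : ∀ t, (Yt t).IsSymm := fun t => isSymm_congr
    (by simp [Matrix.IsSymm, fromBlocks_transpose, hPs.eq, hYs.eq]) _
  have hYq : ∀ t b v, (R *ᵥ Sum.elim b v) ⬝ᵥ Yt t *ᵥ (R *ᵥ Sum.elim b v) =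
      t * (b ⬝ᵥ P *ᵥ b) + v ⬝ᵥ Y *ᵥ v := by
    intro t b v
    simp only [Yt]
    rw [quad_congr, mulVec_mulVec, nonsing_inv_mul _ hRd, one_mulVec, fromBlocks_mulVec_elim,
      sumElim_dotProduct_sumElim]
    simp [smul_mulVec]
  have hRsurj : ∀ a, ∃ b v, a = R *ᵥ Sum.elim b v := by
    intro a
    refine ⟨(R⁻¹ *ᵥ a) ∘ Sum.inl, (R⁻¹ *ᵥ a) ∘ Sum.inr, ?_⟩
    rw [Sum.elim_comp_inl_inr, mulVec_mulVec, mul_nonsing_inv _ hRd, one_mulVec]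
  -- The only `q` that the annihilator condition allows at `a = R (b, v)`.
  let qq : (Fin ℓ → ℝ) → (n → ℝ) → Fin 1 → ℝ := fun b v =>
    dualWeight ρ μ L H v - (lam 0)⁻¹ • ((filterB ℓ)ᵀ *ᵥ b)
  -- The dual inequality is `f + t g > 0`: `g` is the Lyapunov decrease in `b`, and where it
  -- vanishes `b = 0` and `f` is the reduced dual form.
  obtain ⟨t₁, ht₁⟩ := exists_forall_pos_add_mul (E := (Fin ℓ → ℝ) × (n → ℝ))
    (f := fun z => z.2 ⬝ᵥ Y *ᵥ z.2 - (ρ ^ 2)⁻¹ * ((H.Aᵀ *ᵥ z.2) ⬝ᵥ Y *ᵥ (H.Aᵀ *ᵥ z.2))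
      - 2 * (qq z.1 z.2 ⬝ᵥ ((plantBw ρ ℓ H)ᵀ *ᵥ (R *ᵥ Sum.elim z.1 0 + Tᵀ *ᵥ z.2)
        + plantDzw lam *ᵥ qq z.1 z.2)))
    (g := fun z => z.1 ⬝ᵥ P *ᵥ z.1 - (M *ᵥ z.1) ⬝ᵥ P *ᵥ (M *ᵥ z.1))
    (by
      have : Continuous fun z : (Fin ℓ → ℝ) × (n → ℝ) => (Sum.elim z.1 0 : Fin ℓ ⊕ n → ℝ) :=
        continuous_pi fun i => by
          rcases i with i | i
          · exact (continuous_apply i).comp continuous_fst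
          · exact continuous_const
      simp only [qq, dualWeight]
      fun_prop)
    (by fun_prop)
    (fun r z => by
      have h1 : (Sum.elim (r • z.1) 0 : Fin ℓ ⊕ n → ℝ) = r • Sum.elim z.1 0 := by
        ext (i | i) <;> simp
      have h2 : qq (r • z.1) (r • z.2) = r • qq z.1 z.2 := by
        simp only [qq, dualWeight, mulVec_smul, smul_sub]
        rw [smul_comm r, smul_comm r]
      simp only [Prod.smul_fst, Prod.smul_snd, h1, h2, mulVec_smul, ← smul_add, dotProduct_smul,
        smul_dotProduct, smul_eq_mul]
      ring)
    (fun r z => by simp [mulVec_smul]; ring)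
    (fun z => by
      by_cases hz : z.1 = 0
      · simp [hz]
      · linarith [hP z.1 hz])
    (by
      rintro ⟨b, v⟩ hz h0
      have hb : b = 0 := by
        by_contra hb
        have := hP b hb
        simp only at h0
        linarith
      subst hb
      have hv : v ≠ 0 := by
        rintro rfl
        exact hz rfl
      have h1 := hdual v hv
      have h2 : (Sum.elim 0 0 : Fin ℓ ⊕ n → ℝ) = 0 := by ext (i | i) <;> rfl
      simp only [dualForm, plantDzw_transpose, transpose_mul, ← mulVec_mulVec, ← hT] at h1
      simpa [qq, h2] using h1)
  -- The same for coupling: the term `t bᵀ P b` absorbs the filter directions, and at `b = 0` the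
  -- assumed coupling remains.
  obtain ⟨t₂, ht₂⟩ := exists_forall_pos_add_mul
    (E := (Fin ℓ → ℝ) × (n → ℝ) × ((Fin ℓ ⊕ n) → ℝ))
    (f := fun z => z.2.1 ⬝ᵥ Y *ᵥ z.2.1 + 2 * ((R *ᵥ Sum.elim z.1 0 + Tᵀ *ᵥ z.2.1) ⬝ᵥ z.2.2)
      + z.2.2 ⬝ᵥ Xhat *ᵥ z.2.2)
    (g := fun z => z.1 ⬝ᵥ P *ᵥ z.1)
    (by
      have : Continuous fun z : (Fin ℓ → ℝ) × (n → ℝ) × ((Fin ℓ ⊕ n) → ℝ) =>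
          (Sum.elim z.1 0 : Fin ℓ ⊕ n → ℝ) :=
        continuous_pi fun i => by
          rcases i with i | i
          · exact (continuous_apply i).comp continuous_fst
          · exact continuous_const
      fun_prop)
    (by fun_prop)
    (fun r z => by
      have h1 : (Sum.elim (r • z.1) 0 : Fin ℓ ⊕ n → ℝ) = r • Sum.elim z.1 0 := by
        ext (i | i) <;> simp
      simp only [Prod.smul_fst, Prod.smul_snd, h1, mulVec_smul, ← smul_add, dotProduct_smul,
        smul_dotProduct, smul_eq_mul]
      ring)
    (fun r z => by simp [mulVec_smul]; ring)
    (fun z => hPnn z.1)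
    (by
      rintro ⟨b, v, x⟩ hz h0
      have hb : b = 0 := by
        by_contra hb
        have := hP b hb
        have := hPnn (M *ᵥ b)
        simp only at h0
        linarith
      subst hb
      have hv : v ≠ 0 ∨ x ≠ 0 := by
        by_contra! h1
        obtain ⟨rfl, rfl⟩ := h1
        exact hz rfl
      have h1 := hcoup v x hv
      have h2 : (Sum.elim 0 0 : Fin ℓ ⊕ n → ℝ) = 0 := by ext (i | i) <;> rfl
      simpa [h2] using h1)
  have hsplit : ∀ (b : Fin ℓ → ℝ) (v : n → ℝ),
      R *ᵥ Sum.elim b 0 + Tᵀ *ᵥ v = R *ᵥ Sum.elim b v := by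
    intro b v
    rw [hRe, hRe, mulVec_zero, zero_add, add_comm]
  set t := max t₁ t₂ with ht
  have hdualt : (filteredPlant ρ μ L H lam).Dual (Yt t) := by
    intro a q hne h0
    obtain ⟨b, v, rfl⟩ := hRsurj a
    have hq : q = qq b v := by
      have h1 := Sylvester.plantB_transpose hμL hρ0.ne' hAd hN v
      simp only [filteredPlant] at h0
      rw [hRe, mulVec_add] at h0
      have h2 : (plantB ρ μ L ℓ H)ᵀ *ᵥ Sum.elim b 0 = (L - μ) • ((filterB ℓ)ᵀ *ᵥ b) := by
        rw [plantB, transpose_fromRows, fromCols_mulVec_elim, transpose_smul, smul_mulVec]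
        simp
      have h3 : ∀ w : Fin 1 → ℝ, (plantDz μ L lam)ᵀ *ᵥ w = ((L - μ) * lam 0) • w := by
        intro w
        ext i
        rw [Subsingleton.elim i 0]
        simp [plantDz, filterD, mulVec, dotProduct]
      rw [← hT] at h1
      rw [h2, h3] at h0
      rw [h3] at h1
      ext i
      have h4 := congrFun h0 i
      have h5 := congrFun h1 i
      simp only [Pi.add_apply, Pi.smul_apply, smul_eq_mul, Pi.zero_apply] at h4 h5
      simp only [qq, Pi.sub_apply, Pi.smul_apply, smul_eq_mul]
      have h6 : (L - μ) * (lam 0 * (q i - dualWeight ρ μ L H v i) + ((filterB ℓ)ᵀ *ᵥ b) i) = 0 := by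
        linarith
      have h7 := (mul_eq_zero.1 h6).resolve_left hLμ
      field_simp
      linarith
    subst hq
    -- In the coordinates `(b, v)` the adjoint dynamics decouple into the zero dynamics and `ρ⁻¹
    -- A_pᵀ`.
    have hA' : (filteredPlant ρ μ L H lam).Aᵀ *ᵥ (R *ᵥ Sum.elim b v) +
        (filteredPlant ρ μ L H lam).Czᵀ *ᵥ qq b v = R *ᵥ Sum.elim (M *ᵥ b) (ρ⁻¹ • (H.Aᵀ *ᵥ v)) := by
      have h1 := Sylvester.plantA_transpose (L := L) hρ0.ne' hAd hN v
      rw [← hT, ← mulVec_smul] at h1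
      simp only [filteredPlant, qq]
      rw [hRe, hRe, mulVec_add, mulVec_sub, ← h1]
      have h2 : (plantA ρ ℓ H)ᵀ *ᵥ Sum.elim b 0 - (plantCz n lam)ᵀ *ᵥ
          ((lam 0)⁻¹ • ((filterB ℓ)ᵀ *ᵥ b)) = Sum.elim (M *ᵥ b) 0 := by
        rw [plantA, plantCz, fromBlocks_transpose, fromBlocks_mulVec_elim, transpose_fromCols,
          fromRows_mulVec_elim, hM, filterZero]
        ext (i | i)
        · simp [sub_mulVec, transpose_sub, transpose_mul, mulVec_smul, smul_mulVec, mulVec_mulVec]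
        · simp
      rw [← h2]
      abel
    rw [hA', hYq, hYq]
    have hbv : ((b, v) : (Fin ℓ → ℝ) × (n → ℝ)) ≠ 0 := by
      rintro hz
      have hb : b = 0 := congrArg Prod.fst hz
      have hv : v = 0 := congrArg Prod.snd hz
      subst hb hv
      have h2 : (Sum.elim 0 0 : Fin ℓ ⊕ n → ℝ) = 0 := by ext (i | i) <;> rfl
      simp [h2, qq, dualWeight] at hne
    have h1 := ht₁ t (le_max_left _ _) (b, v) hbv
    simp only [hsplit] at h1
    simp only [filteredPlant]
    simp only [mulVec_smul, dotProduct_smul, smul_dotProduct, smul_eq_mul]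
    have h3 : (ρ ^ 2)⁻¹ = ρ⁻¹ * ρ⁻¹ := by rw [sq, mul_inv]
    rw [h3] at h1
    linarith
  have hcoupt : ∀ a x, (a ≠ 0 ∨ x ≠ 0) →
      0 < a ⬝ᵥ Yt t *ᵥ a + 2 * (a ⬝ᵥ x) + x ⬝ᵥ Xhat *ᵥ x := by
    intro a x hne
    obtain ⟨b, v, rfl⟩ := hRsurj a
    rw [hYq]
    have h1 := ht₂ t (le_max_right _ _) (b, v, x) (by
      rintro hz
      have hb : b = 0 := congrArg Prod.fst hz
      have hv : v = 0 := congrArg (fun z => z.2.1) hz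
      have hx : x = 0 := congrArg (fun z => z.2.2) hz
      subst hb hv hx
      have h2 : (Sum.elim 0 0 : Fin ℓ ⊕ n → ℝ) = 0 := by ext (i | i) <;> rfl
      simp [h2] at hne)
    simp only [hsplit] at h1
    linarith
  obtain ⟨X', Y', hX', hY', hYX', hX11, hY11⟩ :=
    exists_certificate_completion e hXs (hYts t) hcoupt
  obtain ⟨Ac, Bc, Cc, Dc, hK⟩ := Plant.exists_controller (filteredPlant ρ μ L H lam) hX' hY' hYX'
    (by rwa [hX11]) (by rwa [hY11])
  -- The factor `ρ` undoes the exponential weighting of the controller.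
  refine ⟨⟨ρ • Ac, ρ • Bc, Cc, Dc⟩, X', ?_⟩
  rw [closedLoop_eq_close]
  simpa [LTI.weighted, smul_smul, inv_mul_cancel₀ hρ0.ne'] using hK

end synthesisConditions


/-! ### Transfer functions -/

theorem map_algebraMap_charmatrix {n : Type} [Fintype n] [DecidableEq n] (A : Matrix n n ℝ) :
    (RatFunc.X : RatFunc ℂ) • (1 : Matrix n n (RatFunc ℂ)) - A.map toRatFunc =
      (algebraMap (Polynomial ℂ) (RatFunc ℂ)).mapMatrix (A.map Complex.ofRealHom).charmatrix := by
  ext i j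
  by_cases h : i = j
  · subst h
    simp [charmatrix, toRatFunc]
  · simp [charmatrix, toRatFunc, h]

theorem det_eq_algebraMap_charpoly {n : Type} [Fintype n] [DecidableEq n] (A : Matrix n n ℝ) :
    ((RatFunc.X : RatFunc ℂ) • (1 : Matrix n n (RatFunc ℂ)) - A.map toRatFunc).det =
      algebraMap (Polynomial ℂ) (RatFunc ℂ) (A.map Complex.ofRealHom).charpoly := by
  rw [map_algebraMap_charmatrix, ← RingHom.map_det]
  rfl

theorem isUnit_resolvent {n : Type} [Fintype n] [DecidableEq n] (A : Matrix n n ℝ) :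
    IsUnit ((RatFunc.X : RatFunc ℂ) • (1 : Matrix n n (RatFunc ℂ)) - A.map toRatFunc) := by
  rw [isUnit_iff_isUnit_det, det_eq_algebraMap_charpoly, isUnit_iff_ne_zero]
  exact RatFunc.algebraMap_ne_zero (charpoly_monic _).ne_zero

/-- The resolvent is the adjugate over the determinant, and the adjugate is polynomial. -/
theorem LTI.exists_transferFunction_mul_charpoly {n : Type} [Fintype n] [DecidableEq n]
    {G : LTI n} (hD : G.D = 0) :
    ∃ p : Polynomial ℂ, G.transferFunction *
      algebraMap (Polynomial ℂ) (RatFunc ℂ) (G.A.map Complex.ofRealHom).charpoly =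
        algebraMap (Polynomial ℂ) (RatFunc ℂ) p := by
  set φ := algebraMap (Polynomial ℂ) (RatFunc ℂ) with hφ
  set M := (RatFunc.X : RatFunc ℂ) • (1 : Matrix n n (RatFunc ℂ)) - G.A.map toRatFunc with hM
  have hdet : M.det = φ (G.A.map Complex.ofRealHom).charpoly := det_eq_algebraMap_charpoly _
  have hne : M.det ≠ 0 := ((isUnit_iff_isUnit_det _).1 (isUnit_resolvent G.A)).ne_zero
  have hadj : M.det • M⁻¹ = φ.mapMatrix (G.A.map Complex.ofRealHom).charmatrix.adjugate := by
    rw [RingHom.map_adjugate, ← map_algebraMap_charmatrix, inv_def, smul_smul, Ring.inverse_eq_inv',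
      mul_inv_cancel₀ hne, one_smul]
  have hmap : ∀ {a b : Type} (W : Matrix a b ℝ),
      W.map toRatFunc = (W.map (fun x : ℝ => Polynomial.C (x : ℂ))).map φ := by
    intro a b W
    ext i j
    simp [toRatFunc, hφ]
  refine ⟨(G.C.map (fun x : ℝ => Polynomial.C (x : ℂ)) *
    (G.A.map Complex.ofRealHom).charmatrix.adjugate *
      G.B.map (fun x : ℝ => Polynomial.C (x : ℂ))) 0 0, ?_⟩
  have h1 : G.transferFunction = (G.C.map toRatFunc * M⁻¹ * G.B.map toRatFunc) 0 0 := by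
    rw [LTI.transferFunction, hD, ← hM]
    simp
  have h2 : G.transferFunction * M.det =
      (G.C.map toRatFunc * (M.det • M⁻¹) * G.B.map toRatFunc) 0 0 := by
    rw [h1, Matrix.mul_smul, Matrix.smul_mul, Matrix.smul_apply, smul_eq_mul, mul_comm]
  rw [← hdet, h2, hadj, hmap, hmap, RingHom.mapMatrix_apply, ← Matrix.map_mul, ← Matrix.map_mul]
  rfl

/-- As `0 ∉ Ω`, numerator and denominator of `H` are coprime, so the denominator divides the
characteristic polynomial; both are monic of degree `|Ω|`. -/
theorem charpoly_eq_of_transferFunction {Ω : Finset ℂ} (h0 : ∀ ω ∈ Ω, ω ≠ 0)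
    {H : LTI (Fin Ω.card)} (hD : H.D = 0) (hH : H.transferFunction = internalModel Ω) :
    (H.A.map Complex.ofRealHom).charpoly = ∏ ω ∈ Ω, (Polynomial.X - Polynomial.C ω) := by
  obtain ⟨p, hp⟩ := LTI.exists_transferFunction_mul_charpoly hD
  rw [hH, internalModel] at hp
  have hprod : ∏ ω ∈ Ω, (RatFunc.X - RatFunc.C ω) = algebraMap (Polynomial ℂ) (RatFunc ℂ)
      (∏ ω ∈ Ω, (Polynomial.X - Polynomial.C ω)) := by
    simp [map_prod]
  have hmonic : (∏ ω ∈ Ω, (Polynomial.X - Polynomial.C ω)).Monic :=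
    Polynomial.monic_prod_of_monic _ _ fun ω _ => Polynomial.monic_X_sub_C ω
  have hne : algebraMap (Polynomial ℂ) (RatFunc ℂ)
      (∏ ω ∈ Ω, (Polynomial.X - Polynomial.C ω)) ≠ 0 :=
    RatFunc.algebraMap_ne_zero hmonic.ne_zero
  rw [hprod, div_mul_eq_mul_div, div_eq_iff hne, ← RatFunc.algebraMap_X, ← map_pow, ← map_mul,
    ← map_mul] at hp
  have hp2 := RatFunc.algebraMap_injective ℂ hp
  have hcop : IsCoprime (∏ ω ∈ Ω, (Polynomial.X - Polynomial.C ω))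
      ((Polynomial.X : Polynomial ℂ) ^ (Ω.card - 1)) := by
    refine IsCoprime.pow_right (IsCoprime.prod_left fun ω hω => ?_)
    have := Polynomial.isCoprime_X_sub_C_of_isUnit_sub (R := ℂ) (a := ω) (b := 0)
      (by simpa using h0 ω hω)
    simpa using this
  have hdvd : (∏ ω ∈ Ω, (Polynomial.X - Polynomial.C ω)) ∣
      (H.A.map Complex.ofRealHom).charpoly :=
    hcop.dvd_of_dvd_mul_left ⟨p, by rw [hp2, mul_comm]⟩
  refine (Polynomial.eq_of_monic_of_dvd_of_natDegree_le hmonic (charpoly_monic _) hdvd ?_).symm ▸ rfl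
  rw [charpoly_natDegree_eq_dim, Polynomial.natDegree_prod_of_monic _ _
    fun ω _ => Polynomial.monic_X_sub_C ω]
  simp

/-- A harmonic of an exosystem with finitely many harmonics is a root of unity. -/
theorem exists_pow_eq_one_of_mem_harmonics {p : ℕ} {ev : Fin p → ℂ} (hev : ∀ i, ev i ≠ 0)
    {Ω : Finset ℂ} (hΩ : (Ω : Set ℂ) = harmonics ev) {ω : ℂ} (hω : ω ∈ Ω) :
    ω ≠ 0 ∧ ∃ m : ℕ, 0 < m ∧ ω ^ m = 1 := by
  obtain ⟨α, rfl⟩ : ω ∈ harmonics ev := hΩ ▸ hω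
  have hne : ∏ i, ev i ^ α i ≠ 0 := Finset.prod_ne_zero_iff.2 fun i _ => pow_ne_zero _ (hev i)
  -- All powers of a harmonic are harmonics, so two of them coincide.
  have hmem : ∀ k : ℕ, (∏ i, ev i ^ α i) ^ k ∈ (Ω : Set ℂ) := by
    intro k
    rw [hΩ]
    refine ⟨fun i => α i * k, ?_⟩
    simp only [pow_mul, Finset.prod_pow]
  obtain ⟨a, b, hab, h⟩ := Ω.finite_toSet.exists_lt_map_eq_of_forall_mem hmem
  refine ⟨hne, b - a, by omega, ?_⟩
  have h2 : (∏ i, ev i ^ α i) ^ a * (∏ i, ev i ^ α i) ^ (b - a) = (∏ i, ev i ^ α i) ^ a * 1 := by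
    rw [← pow_add, mul_one, Nat.add_sub_cancel' hab.le, ← h]
  exact mul_left_cancel₀ (pow_ne_zero _ hne) h2

theorem one_mem_of_eq_harmonics {p : ℕ} {ev : Fin p → ℂ} {Ω : Finset ℂ}
    (hΩ : (Ω : Set ℂ) = harmonics ev) : (1 : ℂ) ∈ Ω := by
  have : (1 : ℂ) ∈ harmonics ev := ⟨fun _ => 0, by simp⟩
  rw [← hΩ] at this
  exact this

/-- The roots are distinct, so the characteristic polynomial divides `X ^ m - 1` for a common
exponent `m`; then Cayley–Hamilton applies. -/
theorem exists_pow_eq_one_of_charpoly {n : Type} [Fintype n] [DecidableEq n] {A : Matrix n n ℝ}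
    {Ω : Finset ℂ} (hΩ : ∀ ω ∈ Ω, ∃ m : ℕ, 0 < m ∧ ω ^ m = 1)
    (hA : (A.map Complex.ofRealHom).charpoly = ∏ ω ∈ Ω, (Polynomial.X - Polynomial.C ω)) :
    ∃ m : ℕ, 0 < m ∧ A ^ m = 1 := by
  choose! f hf using hΩ
  refine ⟨∏ ω ∈ Ω, f ω, Finset.prod_pos fun ω hω => (hf ω hω).1, ?_⟩
  set m := ∏ ω ∈ Ω, f ω with hm
  have hdvd : (∏ ω ∈ Ω, (Polynomial.X - Polynomial.C ω)) ∣ (Polynomial.X ^ m - 1 : Polynomial ℂ) := by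
    refine Finset.prod_dvd_of_coprime ?_ fun ω hω => ?_
    · intro a _ b _ hab
      exact Polynomial.isCoprime_X_sub_C_of_isUnit_sub (sub_ne_zero.2 hab).isUnit
    · rw [Polynomial.dvd_iff_isRoot]
      obtain ⟨c, hc⟩ := Finset.dvd_prod_of_mem f hω
      simp only [Polynomial.IsRoot, Polynomial.eval_sub, Polynomial.eval_pow, Polynomial.eval_X,
        Polynomial.eval_one]
      rw [hm, hc, pow_mul, (hf ω hω).2, one_pow, sub_self]
  obtain ⟨q, hq⟩ := hdvd
  have hCH := aeval_self_charpoly (A.map Complex.ofRealHom)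
  have h1 : Polynomial.aeval (A.map Complex.ofRealHom) (Polynomial.X ^ m - 1 : Polynomial ℂ) = 0 := by
    rw [hq, ← hA, map_mul, hCH, zero_mul]
  simp only [map_sub, map_pow, Polynomial.aeval_X, map_one, sub_eq_zero] at h1
  have h2 : Complex.ofRealHom.mapMatrix (A ^ m) = Complex.ofRealHom.mapMatrix 1 := by
    rw [map_pow, map_one]
    exact h1
  exact Matrix.map_injective Complex.ofReal_injective h2

theorem det_sub_one_eq_zero_of_charpoly {n : Type} [Fintype n] [DecidableEq n] {A : Matrix n n ℝ}
    {Ω : Finset ℂ} (h1 : (1 : ℂ) ∈ Ω)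
    (hA : (A.map Complex.ofRealHom).charpoly = ∏ ω ∈ Ω, (Polynomial.X - Polynomial.C ω)) :
    (1 - A).det = 0 := by
  have h := Matrix.eval_charpoly (A.map Complex.ofRealHom) 1
  rw [hA, Polynomial.eval_prod, Finset.prod_eq_zero h1 (by simp), map_one] at h
  have h2 : Complex.ofRealHom (1 - A).det = 0 := by
    rw [RingHom.map_det, map_sub, map_one]
    exact h.symm
  simpa using h2

/-! ### The cascade of the internal model and the controller -/

section cascade

variable {n m : Type} [Fintype n] [DecidableEq n] [Fintype m] [DecidableEq m]

/-- The series interconnection of a strictly proper system `H`, followed by `K`. -/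
def LTI.cascade {n m : Type} [Fintype n] (H : LTI n) (K : LTI m) : LTI (n ⊕ m) where
  A := fromBlocks H.A 0 (K.B * H.C) K.A
  B := fromRows H.B 0
  C := fromCols (K.D * H.C) K.C
  D := 0

/-- The resolvent of the cascade is block triangular, and its off-diagonal block carries the product
of the two strictly proper parts. -/
theorem LTI.transferFunction_cascade {H : LTI n} (hD : H.D = 0) (K : LTI m) :
    (H.cascade K).transferFunction = K.transferFunction * H.transferFunction := by
  simp only [LTI.transferFunction, LTI.cascade]
  set a := (RatFunc.X : RatFunc ℂ) • (1 : Matrix n n (RatFunc ℂ)) - H.A.map toRatFunc with ha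
  set k := (RatFunc.X : RatFunc ℂ) • (1 : Matrix m m (RatFunc ℂ)) - K.A.map toRatFunc with hk
  have hau : IsUnit a := isUnit_resolvent H.A
  have hku : IsUnit k := isUnit_resolvent K.A
  have hbig : (RatFunc.X : RatFunc ℂ) • (1 : Matrix (n ⊕ m) (n ⊕ m) (RatFunc ℂ)) -
      (fromBlocks H.A 0 (K.B * H.C) K.A).map toRatFunc =
      fromBlocks a 0 (-(K.B.map toRatFunc * H.C.map toRatFunc)) k := by
    rw [← fromBlocks_one, fromBlocks_smul, fromBlocks_map, ha, hk, sub_eq_add_neg, fromBlocks_neg,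
      fromBlocks_add, Matrix.map_mul]
    simp [sub_eq_add_neg]
  have hC : (fromCols (K.D * H.C) K.C).map toRatFunc =
      fromCols (K.D.map toRatFunc * H.C.map toRatFunc) (K.C.map toRatFunc) := by
    rw [← Matrix.map_mul]
    ext i (j | j) <;> rfl
  have hB : (fromRows H.B (0 : Matrix m (Fin 1) ℝ)).map toRatFunc =
      fromRows (H.B.map toRatFunc) 0 := by
    ext (i | i) j
    · rfl
    · simp
  rw [hbig, inv_fromBlocks_zero₁₂_of_isUnit_iff _ _ _ (iff_of_true hau hku), hC, hB, hD,
    fromCols_mul_fromBlocks, fromCols_mul_fromRows]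
  have hprod : ∀ P Q : Matrix (Fin 1) (Fin 1) (RatFunc ℂ), P 0 0 * Q 0 0 = (P * Q) 0 0 := by
    intro P Q
    simp [Matrix.mul_apply]
  rw [hprod]
  have h0 : ∀ (a b : Type), (0 : Matrix a b ℝ).map toRatFunc = 0 := fun a b => by
    ext i j; simp
  rw [h0, add_zero, add_zero]
  simp only [Matrix.mul_zero, add_zero, zero_add, Matrix.mul_neg, Matrix.neg_mul, neg_neg,
    Matrix.add_mul, Matrix.mul_assoc]
  rw [add_comm]

/-- Relabelling of the states of a system. -/
def LTI.relabel {n m : Type} (e : m ≃ n) (G : LTI n) : LTI m where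
  A := G.A.submatrix e e
  B := G.B.submatrix e id
  C := G.C.submatrix id e
  D := G.D

theorem LTI.transferFunction_relabel (e : m ≃ n) (G : LTI n) :
    (G.relabel e).transferFunction = G.transferFunction := by
  simp only [LTI.transferFunction, LTI.relabel]
  have h : (RatFunc.X : RatFunc ℂ) • (1 : Matrix m m (RatFunc ℂ)) -
      (G.A.submatrix e e).map toRatFunc =
      ((RatFunc.X : RatFunc ℂ) • (1 : Matrix n n (RatFunc ℂ)) - G.A.map toRatFunc).submatrix e e := by
    ext i j
    simp [one_apply]
  rw [h, inv_submatrix_equiv, ← submatrix_map, ← submatrix_map, submatrix_mul_equiv,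
    submatrix_mul_equiv]
  rfl

theorem submatrix_pow (e : m ≃ n) (A : Matrix n n ℝ) (k : ℕ) :
    A.submatrix e e ^ k = (A ^ k).submatrix e e := by
  induction k with
  | zero => simp
  | succ k ih => rw [pow_succ, pow_succ, ih, submatrix_mul_equiv]

theorem Detectable.relabel {A : Matrix n n ℝ} {C : Matrix (Fin 1) n ℝ} (e : m ≃ n)
    (h : Detectable A C) : Detectable (A.submatrix e e) (C.submatrix id e) := by
  intro x hx
  have h1 := h (x ∘ e.symm) fun k => by
    have := hx k
    rw [submatrix_pow, submatrix_mulVec_equiv, submatrix_mulVec_equiv] at this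
    simpa [Function.comp_assoc] using this
  rw [tendsto_pi_nhds] at h1 ⊢
  intro i
  simpa [submatrix_pow, submatrix_mulVec_equiv] using h1 (e i)

theorem isAlgorithm_of_fixedPoint {d : ℕ} (hd : 0 < d) {G : LTI n} (hD : G.D = 0)
    (hdet : Detectable G.A G.C) {x : n → ℝ} (hx : G.A *ᵥ x = x) (hCx : G.C *ᵥ x ≠ 0) :
    IsAlgorithm d G := by
  -- Repeat the scalar fixed point in all `d` coordinates; `d > 0` makes the nonzero output visible.
  refine ⟨hD, hdet, fun i => x i.1, ?_, ?_⟩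
  · ext ⟨i, j⟩
    simpa [mulVec, dotProduct, Fintype.sum_prod_type, one_apply] using congrFun hx i
  · intro h0
    apply hCx
    ext i
    simpa [mulVec, dotProduct, Fintype.sum_prod_type, one_apply] using congrFun h0 (i, ⟨0, hd⟩)

theorem IsAlgorithm.relabel_of {d : ℕ} (hd : 0 < d) (e : m ≃ n) {G : LTI n} (hD : G.D = 0)
    (hdet : Detectable G.A G.C) {x : n → ℝ} (hx : G.A *ᵥ x = x) (hCx : G.C *ᵥ x ≠ 0) :
    IsAlgorithm d (G.relabel e) := by
  refine isAlgorithm_of_fixedPoint hd hD (Detectable.relabel e hdet) (x := x ∘ e) ?_ ?_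
  · simp [LTI.relabel, submatrix_mulVec_equiv, Function.comp_assoc, hx]
  · simpa [LTI.relabel, submatrix_mulVec_equiv, Function.comp_assoc] using hCx

variable {ℓ : ℕ}

/-- The embedding of the states of the cascade into those of the closed loop. -/
def embedState (ℓ : ℕ) (x : n ⊕ m → ℝ) : (Fin ℓ ⊕ n) ⊕ m → ℝ :=
  Sum.elim (Sum.elim 0 (x ∘ Sum.inl)) (x ∘ Sum.inr)

theorem embedState_smul (r : ℝ) (x : n ⊕ m → ℝ) :
    embedState ℓ (r • x) = r • embedState ℓ x := by
  ext ((i | i) | i) <;> simp [embedState]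

theorem embedState_ne_zero {x : n ⊕ m → ℝ} (hx : x ≠ 0) : embedState ℓ x ≠ 0 := by
  intro h
  apply hx
  ext (i | i)
  · exact congrFun h (Sum.inl (Sum.inr i))
  · exact congrFun h (Sum.inr i)

theorem continuous_embedState : Continuous (embedState (n := n) (m := m) ℓ) := by
  refine continuous_pi fun i => ?_
  rcases i with (i | i) | i
  · exact continuous_const
  · exact continuous_apply _
  · exact continuous_apply _

/-- As long as its output vanishes, the cascade evolves inside the closed loop. -/
theorem closedLoop_mulVec_embedState (ρ μ L : ℝ) (H : LTI n) (lam : Fin (ℓ + 1) → ℝ) (K : LTI m)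
    {x : n ⊕ m → ℝ} (hx : (H.cascade K).C *ᵥ x = 0) :
    (closedLoop ρ μ L H lam K).A *ᵥ embedState ℓ x =
      ρ⁻¹ • embedState ℓ ((H.cascade K).A *ᵥ x) := by
  obtain ⟨a, b, rfl⟩ : ∃ a b, x = Sum.elim a b := ⟨_, _, (Sum.elim_comp_inl_inr x).symm⟩
  have h := Plant.close_A_mulVec (filteredPlant ρ μ L H lam) (K.weighted ρ).A (K.weighted ρ).B
    (K.weighted ρ).C (K.weighted ρ).D (Sum.elim 0 a) b 0
  rw [← closedLoop_eq_close, mulVec_zero, add_zero, mulVec_zero, add_zero] at h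
  have hy : (filteredPlant ρ μ L H lam).C *ᵥ Sum.elim 0 a = H.C *ᵥ a := by
    simp [filteredPlant, plantC]
  -- The output of the cascade is the control input, and weighting changes neither `C` nor `D`.
  have hu : (K.weighted ρ).D *ᵥ (H.C *ᵥ a) + (K.weighted ρ).C *ᵥ b = 0 := by
    simpa [LTI.cascade, fromCols_mulVec_elim, ← mulVec_mulVec, LTI.weighted] using hx
  rw [hy, hu, mulVec_zero, add_zero] at h
  change (closedLoop ρ μ L H lam K).A *ᵥ Sum.elim (Sum.elim 0 a) b = _
  rw [h, LTI.cascade, fromBlocks_mulVec_elim, ← embedState_smul]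
  ext ((i | i) | i)
  · simp [filteredPlant, plantA, embedState, fromBlocks_mulVec_elim]
  · simp [filteredPlant, plantA, embedState, fromBlocks_mulVec_elim, smul_mulVec]
  · simp [embedState, LTI.weighted, smul_mulVec, mul_add, ← mulVec_mulVec]

/-- With `q = 0` and zero output the loop acts as `ρ⁻¹` times the cascade, so dissipation becomes
contraction by `ρ²`. -/
theorem AnalysisLMI.quad_embedState_le {ρ μ L : ℝ} (hρ0 : 0 < ρ) {H : LTI n}
    {lam : Fin (ℓ + 1) → ℝ} {K : LTI m} {X : Matrix ((Fin ℓ ⊕ n) ⊕ m) ((Fin ℓ ⊕ n) ⊕ m) ℝ}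
    (h : AnalysisLMI (closedLoop ρ μ L H lam K) X) {x : n ⊕ m → ℝ}
    (hx : (H.cascade K).C *ᵥ x = 0) :
    embedState ℓ ((H.cascade K).A *ᵥ x) ⬝ᵥ X *ᵥ embedState ℓ ((H.cascade K).A *ᵥ x) ≤
      ρ ^ 2 * (embedState ℓ x ⬝ᵥ X *ᵥ embedState ℓ x) := by
  by_cases h0 : x = 0
  · subst h0
    have : embedState ℓ (0 : n ⊕ m → ℝ) = 0 := by ext ((i | i) | i) <;> rfl
    simp [this]
  · have h1 := ((analysisLMI_iff _ _).1 h).2 (embedState ℓ x) 0 (Or.inl (embedState_ne_zero h0))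
    rw [mulVec_zero, add_zero, closedLoop_mulVec_embedState ρ μ L H lam K hx] at h1
    simp only [mulVec_smul, dotProduct_smul, smul_dotProduct, smul_eq_mul, zero_dotProduct] at h1
    field_simp at h1
    linarith

theorem AnalysisLMI.detectable_cascade {ρ μ L : ℝ} (hρ0 : 0 < ρ) (hρ1 : ρ < 1) {H : LTI n}
    {lam : Fin (ℓ + 1) → ℝ} {K : LTI m} {X : Matrix ((Fin ℓ ⊕ n) ⊕ m) ((Fin ℓ ⊕ n) ⊕ m) ℝ}
    (h : AnalysisLMI (closedLoop ρ μ L H lam K) X) :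
    Detectable (H.cascade K).A (H.cascade K).C := by
  intro x hx
  set A := (H.cascade K).A with hA
  -- This bounds the squared norm by a multiple of the storage.
  obtain ⟨t, ht⟩ := exists_forall_pos_add_mul (E := n ⊕ m → ℝ) (f := fun x => -‖x‖ ^ 2)
    (g := fun x => embedState ℓ x ⬝ᵥ X *ᵥ embedState ℓ x)
    (by fun_prop)
    (by have := continuous_embedState (n := n) (m := m) (ℓ := ℓ); fun_prop)
    (fun r x => by rw [norm_smul, mul_pow, Real.norm_eq_abs, sq_abs]; ring)
    (fun r x => by
      simp only [embedState_smul, mulVec_smul, dotProduct_smul, smul_dotProduct, smul_eq_mul]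
      ring)
    (fun x => PosDef.nonneg h.1 _)
    (fun x hx h0 => absurd h0 (PosDef.pos_of_ne_zero h.1 (embedState_ne_zero hx)).ne')
  have hV : ∀ k : ℕ, embedState ℓ (A ^ k *ᵥ x) ⬝ᵥ X *ᵥ embedState ℓ (A ^ k *ᵥ x) ≤
      (ρ ^ 2) ^ k * (embedState ℓ x ⬝ᵥ X *ᵥ embedState ℓ x) := by
    intro k
    induction k with
    | zero => simp
    | succ k ih =>
      have h1 := AnalysisLMI.quad_embedState_le hρ0 h (hx k)
      rw [← hA, mulVec_mulVec, ← pow_succ'] at h1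
      have h2 := mul_le_mul_of_nonneg_left ih (sq_nonneg ρ)
      rw [pow_succ (ρ ^ 2)]
      linarith
  set t' := max t 0 with ht'
  have hnorm : ∀ k : ℕ, ‖A ^ k *ᵥ x‖ ^ 2 ≤
      (ρ ^ 2) ^ k * (t' * (embedState ℓ x ⬝ᵥ X *ᵥ embedState ℓ x)) := by
    intro k
    have h1 : ‖A ^ k *ᵥ x‖ ^ 2 ≤
        t' * (embedState ℓ (A ^ k *ᵥ x) ⬝ᵥ X *ᵥ embedState ℓ (A ^ k *ᵥ x)) := by
      by_cases h0 : A ^ k *ᵥ x = 0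
      · rw [h0, norm_zero]
        have := mul_nonneg (le_max_right t 0) (PosDef.nonneg h.1 (embedState ℓ (0 : n ⊕ m → ℝ)))
        simpa using this
      · linarith [ht t' (le_max_left _ _) _ h0]
    have h2 := mul_le_mul_of_nonneg_left (hV k) (le_max_right t 0)
    linarith
  have hlim : Filter.Tendsto (fun k : ℕ => ‖A ^ k *ᵥ x‖ ^ 2) Filter.atTop (nhds 0) := by
    refine squeeze_zero (fun k => sq_nonneg _) hnorm ?_
    have := tendsto_pow_atTop_nhds_zero_of_lt_one (sq_nonneg ρ) (by nlinarith : ρ ^ 2 < 1)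
    simpa using this.mul_const (t' * (embedState ℓ x ⬝ᵥ X *ᵥ embedState ℓ x))
  rw [tendsto_zero_iff_norm_tendsto_zero]
  have := hlim.sqrt
  simpa [Real.sqrt_sq] using this

theorem AnalysisLMI.cascade_output_ne_zero {ρ μ L : ℝ} (hρ0 : 0 < ρ) (hρ1 : ρ < 1) {H : LTI n}
    {lam : Fin (ℓ + 1) → ℝ} {K : LTI m} {X : Matrix ((Fin ℓ ⊕ n) ⊕ m) ((Fin ℓ ⊕ n) ⊕ m) ℝ}
    (h : AnalysisLMI (closedLoop ρ μ L H lam K) X) {x : n ⊕ m → ℝ} (hx : x ≠ 0)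
    (hAx : (H.cascade K).A *ᵥ x = x) : (H.cascade K).C *ᵥ x ≠ 0 := by
  intro h0
  have h1 := AnalysisLMI.quad_embedState_le hρ0 h h0
  rw [hAx] at h1
  have h2 := PosDef.pos_of_ne_zero h.1 (embedState_ne_zero (ℓ := ℓ) hx)
  have h3 : ρ ^ 2 < 1 := by nlinarith
  nlinarith

/-- The cascade is block triangular, so it inherits the eigenvalue `1` of the internal model. -/
theorem LTI.exists_cascade_fixedPoint {H : LTI n} (hH : (1 - H.A).det = 0) (K : LTI m) :
    ∃ x, x ≠ 0 ∧ (H.cascade K).A *ᵥ x = x := by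
  have hdet : (1 - (H.cascade K).A).det = 0 := by
    rw [LTI.cascade, ← fromBlocks_one, sub_eq_add_neg, fromBlocks_neg, fromBlocks_add, neg_zero,
      add_zero, det_fromBlocks_zero₁₂, ← sub_eq_add_neg, hH, zero_mul]
  obtain ⟨x, hx, h⟩ := exists_mulVec_eq_zero_iff.2 hdet
  rw [sub_mulVec, one_mulVec, sub_eq_zero] at h
  exact ⟨x, hx, h.symm⟩

end cascade


/-! ### Convexity -/

section convexity

variable {n : Type} [Fintype n] [DecidableEq n] {ℓ : ℕ}

theorem plantCz_linear (a b : ℝ) (lam lam' : Fin (ℓ + 1) → ℝ) :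
    plantCz n (a • lam + b • lam') = a • plantCz n lam + b • plantCz n lam' := by
  ext i (j | j) <;> simp [plantCz, filterC]

theorem plantDzw_linear (a b : ℝ) (lam lam' : Fin (ℓ + 1) → ℝ) :
    plantDzw (a • lam + b • lam') = a • plantDzw lam + b • plantDzw lam' := by
  ext i j
  simp [plantDzw, filterD]
  ring

theorem tildeT_linear (ρ μ L : ℝ) (H : LTI n) (a b : ℝ) (lam lam' : Fin (ℓ + 1) → ℝ)
    (N N' : Matrix n (Fin ℓ) ℝ) :
    tildeT ρ μ L H (a • lam + b • lam') (a • N + b • N') =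
      a • tildeT ρ μ L H lam N + b • tildeT ρ μ L H lam' N' := by
  have h : filterEval ρ H.A (a • lam + b • lam') =
      a • filterEval ρ H.A lam + b • filterEval ρ H.A lam' := by
    simp only [filterEval, Finset.smul_sum, ← Finset.sum_add_distrib, smul_smul, ← add_smul]
    refine Finset.sum_congr rfl fun j _ => ?_
    congr 1
    simp
    ring
  rw [tildeT_eq, tildeT_eq, tildeT_eq, h]
  ext i (j | j)
  · simp
    ring
  · simp

theorem convex_zfParams (ρ : ℝ) (ℓ : ℕ) : Convex ℝ (zfParams ρ ℓ) := by
  rintro lam ⟨h1, h2⟩ lam' ⟨h1', h2'⟩ a b ha hb _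
  refine ⟨fun j => ?_, ?_⟩
  · have := mul_nonneg ha (neg_nonneg.2 (h1 j))
    have := mul_nonneg hb (neg_nonneg.2 (h1' j))
    simp only [Pi.add_apply, Pi.smul_apply, smul_eq_mul]
    linarith
  · have h : ∑ j : Fin (ℓ + 1), (ρ ^ (j : ℕ))⁻¹ * (a • lam + b • lam') j =
        a * ∑ j : Fin (ℓ + 1), (ρ ^ (j : ℕ))⁻¹ * lam j +
          b * ∑ j : Fin (ℓ + 1), (ρ ^ (j : ℕ))⁻¹ * lam' j := by
      simp only [Finset.mul_sum, ← Finset.sum_add_distrib]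
      refine Finset.sum_congr rfl fun j _ => ?_
      simp
      ring
    rw [h]
    positivity

theorem Sylvester.linear {ρ μ : ℝ} {H : LTI n} {lam lam' : Fin (ℓ + 1) → ℝ}
    {N N' : Matrix n (Fin ℓ) ℝ} (h : Sylvester ρ μ H lam N) (h' : Sylvester ρ μ H lam' N')
    (a b : ℝ) : Sylvester ρ μ H (a • lam + b • lam') (a • N + b • N') := by
  unfold Sylvester at *
  have hC : filterC (a • lam + b • lam') = a • filterC lam + b • filterC lam' := by
    ext i j
    simp [filterC]
  have : H.A * (a • N + b • N') - ρ • ((a • N + b • N') * filterA ℓ)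
      + μ • (H.B * filterC (a • lam + b • lam')) =
      a • (H.A * N - ρ • (N * filterA ℓ) + μ • (H.B * filterC lam)) +
      b • (H.A * N' - ρ • (N' * filterA ℓ) + μ • (H.B * filterC lam')) := by
    rw [hC]
    simp only [Matrix.mul_add, Matrix.add_mul, Matrix.mul_smul, Matrix.smul_mul, smul_add, smul_sub]
    rw [smul_comm a ρ, smul_comm a μ, smul_comm b ρ, smul_comm b μ]
    abel
  rw [this, h, h', smul_zero, smul_zero, add_zero]

/-- `T̃` is jointly linear in `(N, λ)` and the kernel bases do not depend on the unknowns, so each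
inequality, tested on a fixed vector, is linear in the unknowns. -/
theorem convex_synthesisSet {ρ μ L : ℝ} (hμL : μ < L) (ℓ : ℕ) {k₁ k₂ : Type} [Fintype k₁]
    [Fintype k₂] {H : LTI n} {Cperp : Matrix n k₁ ℝ} (hC : IsKernelBasis H.C Cperp)
    {Vt : Matrix (n ⊕ Fin 1) k₂ ℝ} (hV : IsKernelBasis (dualRow ρ μ L H) Vt) :
    Convex ℝ (synthesisSet ρ μ L ℓ H Cperp Vt) := by
  rintro ⟨N, X, Y, lam⟩ ⟨hX, hY, hlam, hN, h⟩ ⟨N', X', Y', lam'⟩ ⟨hX', hY', hlam', hN', h'⟩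
    a b ha hb hab
  dsimp only at hX hY hlam hN h hX' hY' hlam' hN' h'
  have hXc : (a • X + b • X').IsSymm := (hX.smul a).add (hX'.smul b)
  have hYc : (a • Y + b • Y').IsSymm := (hY.smul a).add (hY'.smul b)
  have hpos : ∀ {r s : ℝ}, 0 < r → 0 < s → 0 < a * r + b * s := fun hr hs =>
    convex_Ioi (0 : ℝ) hr hs ha hb hab
  change (a • N + b • N', a • X + b • X', a • Y + b • Y', a • lam + b • lam') ∈ _
  refine ⟨hXc, hYc, convex_zfParams ρ ℓ hlam hlam' ha hb hab, Sylvester.linear hN hN' a b,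
    ?_, ?_, ?_⟩ <;> dsimp only
  · have h1 := (primal_iff ρ μ L hC lam hX).1 h.primal
    have h1' := (primal_iff ρ μ L hC lam' hX').1 h'.primal
    refine (primal_iff ρ μ L hC _ hXc).2 fun x q hne hx => ?_
    refine neg_pos.1 (lt_of_lt_of_eq
      (hpos (neg_pos.2 (h1 x q hne hx)) (neg_pos.2 (h1' x q hne hx))) ?_)
    simp only [filteredPlant, plantCz_linear, plantDzw_linear]
    generalize plantA ρ ℓ H *ᵥ x + plantBw ρ ℓ H *ᵥ q = s
    simp only [add_mulVec, smul_mulVec, dotProduct_add, dotProduct_smul, smul_eq_mul]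
    ring
  · have h1 := (dual_iff hμL hV lam N hY).1 h.dual
    have h1' := (dual_iff hμL hV lam' N' hY').1 h'.dual
    refine (dual_iff hμL hV _ _ hYc).2 fun v hv => ?_
    have := hpos (h1 v hv) (h1' v hv)
    refine lt_of_lt_of_eq this ?_
    simp only [dualForm, tildeT_linear, plantDzw_linear, Matrix.add_mul, Matrix.smul_mul,
      transpose_add, transpose_smul, add_mulVec, smul_mulVec, dotProduct_add, dotProduct_smul,
      smul_eq_mul]
    ring
  · have h1 := (coupling_iff hY hX).1 h.coupling
    have h1' := (coupling_iff hY' hX').1 h'.coupling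
    refine (coupling_iff hYc hXc).2 fun v x hne => ?_
    have := hpos (h1 v x hne) (h1' v x hne)
    refine lt_of_lt_of_eq this ?_
    simp only [tildeT_linear, transpose_add, transpose_smul, add_mulVec, smul_mulVec,
      dotProduct_add, dotProduct_smul, add_dotProduct, smul_dotProduct, smul_eq_mul]
    ring

end convexity

end TVOpt
end

/-! ### The main theorem -/

theorem theorem2 {p : ℕ} (S : Matrix (Fin p) (Fin p) ℝ) (ev : Fin p → ℂ)
    (hS : TVOpt.IsExosystem S ev)
    (Ω : Finset ℂ) (hΩ : (Ω : Set ℂ) = TVOpt.harmonics ev)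
    (d : ℕ) (hd : 0 < d)
    (μ L ρ : ℝ) (hμ : 0 < μ) (hμL : μ < L) (hρ0 : 0 < ρ) (hρ1 : ρ < 1) (ℓ : ℕ)
    (H : TVOpt.LTI (Fin Ω.card)) (hHD : H.D = 0)
    (hH : H.transferFunction = TVOpt.internalModel Ω)
    {k₁ k₂ : ℕ} (Cperp : Matrix (Fin Ω.card) (Fin k₁) ℝ)
    (hCperp : TVOpt.IsKernelBasis H.C Cperp)
    (Vt : Matrix (Fin Ω.card ⊕ Fin 1) (Fin k₂) ℝ)
    (hVt : TVOpt.IsKernelBasis (TVOpt.dualRow ρ μ L H) Vt) :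
    ((∃ (n : ℕ) (G : TVOpt.LTI (Fin n)), TVOpt.IsAlgorithm d G ∧
        ∃ (nc : ℕ) (K : TVOpt.LTI (Fin nc)),
          G.transferFunction = K.transferFunction * TVOpt.internalModel Ω ∧
          ∃ X : Matrix ((Fin ℓ ⊕ Fin Ω.card) ⊕ Fin nc) ((Fin ℓ ⊕ Fin Ω.card) ⊕ Fin nc) ℝ,
          ∃ lam ∈ TVOpt.zfParams ρ ℓ,
            X.IsSymm ∧ TVOpt.AnalysisLMI (TVOpt.closedLoop ρ μ L H lam K) X) ↔
      (∃ (N : Matrix (Fin Ω.card) (Fin ℓ) ℝ)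
         (Xhat : Matrix (Fin ℓ ⊕ Fin Ω.card) (Fin ℓ ⊕ Fin Ω.card) ℝ)
         (Ytilde : Matrix (Fin Ω.card) (Fin Ω.card) ℝ),
         ∃ lam ∈ TVOpt.zfParams ρ ℓ,
           Xhat.IsSymm ∧ Ytilde.IsSymm ∧ TVOpt.Sylvester ρ μ H lam N ∧
           TVOpt.SynthesisLMI ρ μ L H Cperp Vt N Xhat Ytilde lam)) ∧
    Convex ℝ (TVOpt.synthesisSet ρ μ L ℓ H Cperp Vt) := by
  have hroots := fun ω (hω : ω ∈ Ω) => TVOpt.exists_pow_eq_one_of_mem_harmonics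
    (fun i h0 => by simpa [h0] using hS.unitModulus i) hΩ hω
  have hchar := TVOpt.charpoly_eq_of_transferFunction (fun ω hω => (hroots ω hω).1) hHD hH
  obtain ⟨m, hm, hAm⟩ :=
    TVOpt.exists_pow_eq_one_of_charpoly (fun ω hω => (hroots ω hω).2) hchar
  have hdet := TVOpt.det_sub_one_eq_zero_of_charpoly (TVOpt.one_mem_of_eq_harmonics hΩ) hchar
  refine ⟨⟨?_, ?_⟩, TVOpt.convex_synthesisSet hμL ℓ hCperp hVt⟩
  · rintro ⟨_, _, _, _, K, _, X, lam, hlam, _, hX⟩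
    obtain ⟨N, Xhat, Y, hXs, hYs, hN, h⟩ :=
      TVOpt.exists_synthesis_of_analysis hμL hρ0 hρ1 hm hAm hCperp hVt hlam hX
    exact ⟨N, Xhat, Y, lam, hlam, hXs, hYs, hN, h⟩
  · rintro ⟨N, Xhat, Y, lam, hlam, hXs, hYs, hN, h⟩
    -- The controller has the order `ℓ + n_p` of the filtered plant; its cascade with `H` is the
    -- required algorithm.
    obtain ⟨K, X, hX⟩ := TVOpt.exists_controller_of_synthesis hμL hρ0 hρ1 hm hAm hCperp hVt
      (finSumFinEquiv (m := ℓ) (n := Ω.card)).symm hlam hXs hYs hN h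
    obtain ⟨x, hx, hAx⟩ := TVOpt.LTI.exists_cascade_fixedPoint hdet K
    refine ⟨Ω.card + (ℓ + Ω.card), (H.cascade K).relabel finSumFinEquiv.symm,
      TVOpt.IsAlgorithm.relabel_of hd _ rfl (TVOpt.AnalysisLMI.detectable_cascade hρ0 hρ1 hX) hAx
        (TVOpt.AnalysisLMI.cascade_output_ne_zero hρ0 hρ1 hX hx hAx),
      ℓ + Ω.card, K, ?_, X, lam, hlam, TVOpt.PosDef.isSymm_real hX.1, hX⟩
    rw [TVOpt.LTI.transferFunction_relabel, TVOpt.LTI.transferFunction_cascade hHD, hH]
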